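/- Let $n\geq 1$ and let $\lambda$ be a partition of $n$ with transposed partition $\lambda'$. A $\lambda$-tableau $[a]$ is a bijective filling of the boxes of the Young diagram of $\lambda$ with $1,\dots,n$; the $\lambda$-tabloid $\{a\}$ is its class modulo permuting entries within rows. Let $M^\lambda$ be the free $\mathbb{Z}$-module on the $\lambda$-tabloids, with the bilinear form for which the tabloids are an orthonormal basis. The symmetric group $\mathcal{S}_n$ operates entrywise on tableaux and tabloids. The Specht module $S^\lambda\subseteq M^\lambda$ is the $\mathbb{Z}$-span of the polytabloids $\langle a\rangle=\sum_{\sigma\in C_a}\operatorname{sgn}(\sigma)\,\{a\}\sigma$, where $[a]$ runs over the $\lambda$-tableaux and $C_a\leq\mathcal{S}_n$ is the column stabilizer of $[a]$. Let $n_\lambda:=\operatorname{rk}_{\mathbb{Z}}S^\lambda$. The Gram matrix of $S^\lambda$ is the matrix of the restricted bilinear form with respect to any $\mathbb{Z}$-basis of $S^\lambda$. The elementary divisors of an integer matrix $G\in\mathbb{Z}^{m\times m}$ are the non-negative integers $d_1\mid d_2\mid\dots\mid d_m$ with $UGV=\operatorname{diag}(d_1,\dots,d_m)$ for some $U,V\in\mathrm{GL}_m(\mathbb{Z})$.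 Then $n_\lambda\geq 1$, $n_{\lambda'}=n_\lambda$, $n_\lambda$ divides $n!$, and for every $i\in\{1,\dots,n_\lambda\}$ the product of the $i$-th elementary divisor of the Gram matrix of $S^\lambda$ and the $(n_\lambda+1-i)$-th elementary divisor of the Gram matrix of $S^{\lambda'}$ equals $n!/n_\lambda$. In particular, the largest (i.e. $n_\lambda$-th) elementary divisor of the Gram matrix of $S^\lambda$ divides $n!/n_\lambda$. -/

import Mathlib

namespace Specht

/-- A `μ`-tableau: a bijective filling of the boxes of the Young diagram `μ` (rows are indexed by
the first, columns by the second coordinate) with the `n` letters of `Fin n`. -/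
abbrev Tableau (n : ℕ) (μ : YoungDiagram) : Type := {c : ℕ × ℕ // c ∈ μ.cells} ≃ Fin n

namespace Tableau

variable {n : ℕ} {μ : YoungDiagram}

/-- The row of the letter `k` in the tableau `a`. -/
def row (a : Tableau n μ) (k : Fin n) : ℕ := (a.symm k).1.1

/-- The column of the letter `k` in the tableau `a`. -/
def col (a : Tableau n μ) (k : Fin n) : ℕ := (a.symm k).1.2

/-- The entrywise operation of a permutation on a tableau: each entry `k` is replaced by `σ k`. -/
def permute (a : Tableau n μ) (σ : Equiv.Perm (Fin n)) : Tableau n μ := a.trans σ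

/-- The column stabilizer `C_a` of the tableau `a`. -/
def colStabilizer (a : Tableau n μ) : Subgroup (Equiv.Perm (Fin n)) where
  carrier := {σ | ∀ k, a.col (σ k) = a.col k}
  mul_mem' := by
    intro σ τ hσ hτ k
    exact (hσ (τ k)).trans (hτ k)
  one_mem' := fun _ => rfl
  inv_mem' := by
    intro σ hσ k
    have h := hσ (σ⁻¹ k)
    rw [show σ (σ⁻¹ k) = k from σ.apply_symm_apply k] at h
    exact h.symm

/-- Two tableaux are row equivalent if each letter lies in the same row of both. -/
def rowSetoid (n : ℕ) (μ : YoungDiagram) : Setoid (Tableau n μ) where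
  r a b := ∀ k, a.row k = b.row k
  iseqv :=
    { refl := fun _ _ => rfl
      symm := fun h k => (h k).symm
      trans := fun h h' k => (h k).trans (h' k) }

end Tableau

/-- A `μ`-tabloid: a `μ`-tableau with unordered rows. -/
def Tabloid (n : ℕ) (μ : YoungDiagram) : Type := Quotient (Tableau.rowSetoid n μ)

/-- The tabloid `{a}` of a tableau `a`. -/
def tabloid {n : ℕ} {μ : YoungDiagram} (a : Tableau n μ) : Tabloid n μ :=
  Quotient.mk (Tableau.rowSetoid n μ) a

/-- The free `ℤ`-module `M^μ` on the set of `μ`-tabloids. -/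
abbrev PermModule (n : ℕ) (μ : YoungDiagram) : Type := Tabloid n μ →₀ ℤ

/-- The bilinear form on `M^μ` for which the tabloids are an orthonormal basis. -/
noncomputable def form (n : ℕ) (μ : YoungDiagram) : LinearMap.BilinForm ℤ (PermModule n μ) :=
  Finsupp.linearCombination ℤ fun t : Tabloid n μ => Finsupp.lapply (R := ℤ) (M := ℤ) t

open Classical in
theorem form_tabloid {n : ℕ} {μ : YoungDiagram} (s t : Tabloid n μ) :
    form n μ (Finsupp.single s 1) (Finsupp.single t 1) = if s = t then 1 else 0 := by
  simp [form, Finsupp.single_apply, eq_comm]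

open Classical in
/-- The polytabloid of the tableau `a`: the alternating sum of the tabloids `{aσ}` over the column
stabilizer of `a`. -/
noncomputable def polytabloid {n : ℕ} {μ : YoungDiagram} (a : Tableau n μ) : PermModule n μ :=
  ∑ σ : a.colStabilizer,
    ((Equiv.Perm.sign (σ : Equiv.Perm (Fin n)) : ℤˣ) : ℤ) •
      Finsupp.single (tabloid (a.permute (σ : Equiv.Perm (Fin n)))) (1 : ℤ)

/-- The Specht lattice `S^μ`: the `ℤ`-linear span of the polytabloids in `M^μ`. -/
noncomputable def spechtModule (n : ℕ) (μ : YoungDiagram) : Submodule ℤ (PermModule n μ) :=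
  Submodule.span ℤ (Set.range fun a : Tableau n μ => polytabloid a)

/-- The `ℤ`-rank `n_μ` of the Specht lattice. -/
noncomputable def spechtRank (n : ℕ) (μ : YoungDiagram) : ℕ :=
  Module.finrank ℤ (spechtModule n μ)

/-- The Gram matrix, with respect to a `ℤ`-basis of the Specht lattice, of the restriction of the
bilinear form on `M^μ` to `S^μ`. -/
noncomputable def gramMatrix {n : ℕ} {μ : YoungDiagram} {m : ℕ}
    (b : Module.Basis (Fin m) ℤ (spechtModule n μ)) : Matrix (Fin m) (Fin m) ℤ :=
  Matrix.of fun i j => form n μ (b i) (b j)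

/-- `d` is the sequence of elementary divisors of the square integer matrix `G`: each term divides
the next ones, and `G` is brought into the diagonal form given by `d` by multiplication with
invertible integer matrices on both sides. -/
def IsElementaryDivisors {m : ℕ} (G : Matrix (Fin m) (Fin m) ℤ) (d : Fin m → ℕ) : Prop :=
  (∀ i j, i ≤ j → d i ∣ d j) ∧
    ∃ U V : (Matrix (Fin m) (Fin m) ℤ)ˣ,
      (U : Matrix (Fin m) (Fin m) ℤ) * G * (V : Matrix (Fin m) (Fin m) ℤ) =
        Matrix.diagonal fun i => (d i : ℤ)

end Specht

/-! Fix a tableau `a₀` and let `N` be the matrix, with rows indexed by tabloids of `μ` and columns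
by tabloids of `μ.transpose`, whose entry is the sign relative to `a₀` of the unique tableau with
the given rows and columns, or 0 if there is none. Up to sign its columns are the polytabloids of
`μ` and its rows those of `μ.transpose`, so one matrix carries both Specht lattices.

Permutations act on rows and columns of `N` with `N` changing by the sign. A matrix with this
equivariance is a multiple of `N` (`SignEquivariant.eq_smul`): if two letters share a row of one
tabloid and a column of the other, their transposition forces the entry to vanish; otherwise a
common tableau exists, and all tableaux form a single orbit. Hence `N * Nᵀ * N = c • N` for some
integer `c`.

Standard polytabloids give a factorization `N = P * Q` over ℤ, with `P` left invertible and `Q`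
right invertible (`incidence_eq_mul`). The columns of `P` are then a basis of the lattice of `μ`,
the rows of `Q` one of the lattice of `μ.transpose`, and the ranks agree. Cancelling `P` and `Q` in
the cubic relation shows that the Gram matrices `Pᵀ * P` and `Q * Qᵀ` have product `c`. The trace of
`N * Nᵀ` counts tableaux, so `c` times the rank is `n!`.

Finally, integer matrices with product `c` have complementary elementary divisors
(`elementaryDivisors_mul_eq`). -/

namespace Specht

open Matrix

/-! ### Smith normal form over ℤ and complementary elementary divisors. -/

section ElementaryDivisors

/-- The bordered matrix with corner `x`, first row `x, r`, first column `x, c` and remaining block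
`A`. -/
def bordered {m : ℕ} (x : ℤ) (r c : Fin m → ℤ) (A : Matrix (Fin m) (Fin m) ℤ) :
    Matrix (Fin (m + 1)) (Fin (m + 1)) ℤ :=
  Matrix.of (Fin.cons (Fin.cons x r) fun i => Fin.cons (c i) (A i))

theorem bordered_mul {m : ℕ} (x y : ℤ) (r c s d : Fin m → ℤ) (A B : Matrix (Fin m) (Fin m) ℤ) :
    bordered x r c A * bordered y s d B =
      bordered (x * y + r ⬝ᵥ d) (x • s + r ᵥ* B) (y • c + A *ᵥ d) (vecMulVec c s + A * B) := by
  ext i j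
  refine Fin.cases ?_ (fun i => ?_) i <;> refine Fin.cases ?_ (fun j => ?_) j <;>
    simp [bordered, Matrix.mul_apply, Fin.sum_univ_succ, dotProduct, vecMul, mulVec, vecMulVec,
      mul_comm]

theorem bordered_one {m : ℕ} : bordered 1 0 0 (1 : Matrix (Fin m) (Fin m) ℤ) = 1 := by
  ext i j
  refine Fin.cases ?_ (fun i => ?_) i <;> refine Fin.cases ?_ (fun j => ?_) j <;>
    simp [bordered, Matrix.one_apply, Fin.succ_ne_zero, (Fin.succ_ne_zero _).symm]

theorem eq_bordered {m : ℕ} (H : Matrix (Fin (m + 1)) (Fin (m + 1)) ℤ) :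
    H = bordered (H 0 0) (fun j => H 0 j.succ) (fun i => H i.succ 0)
      (of fun i j => H i.succ j.succ) := by
  ext i j
  refine Fin.cases ?_ (fun i => ?_) i <;> refine Fin.cases ?_ (fun j => ?_) j <;> simp [bordered]

theorem isUnit_bordered_col {m : ℕ} (q : Fin m → ℤ) : IsUnit (bordered 1 0 q 1) :=
  IsUnit.of_mul_eq_one (bordered 1 0 (-q) 1) (by simp [bordered_mul, bordered_one])

theorem isUnit_bordered_row {m : ℕ} (q : Fin m → ℤ) : IsUnit (bordered 1 q 0 1) :=
  IsUnit.of_mul_eq_one (bordered 1 (-q) 0 1) (by simp [bordered_mul, bordered_one])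

theorem isUnit_bordered {m : ℕ} {A : Matrix (Fin m) (Fin m) ℤ} (hA : IsUnit A) :
    IsUnit (bordered 1 0 0 A) := by
  obtain ⟨B, hB⟩ := hA.exists_right_inv
  exact IsUnit.of_mul_eq_one (bordered 1 0 0 B) (by simp [bordered_mul, bordered_one, hB])

theorem isUnit_swapMatrix {m : ℕ} (i j : Fin m) : IsUnit (Matrix.swap ℤ i j) :=
  IsUnit.of_mul_eq_one (Matrix.swap ℤ i j) (Matrix.swap_mul_self i j)

/-- The corner of `H` is nonzero and minimal, in absolute value, among the nonzero corners of the
matrices equivalent to `H`. -/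
def MinimalCorner {m : ℕ} (H : Matrix (Fin (m + 1)) (Fin (m + 1)) ℤ) : Prop :=
  H 0 0 ≠ 0 ∧ ∀ U V : Matrix (Fin (m + 1)) (Fin (m + 1)) ℤ, IsUnit U → IsUnit V →
    (U * H * V) 0 0 ≠ 0 → |H 0 0| ≤ |(U * H * V) 0 0|

theorem MinimalCorner.transpose {m : ℕ} {H : Matrix (Fin (m + 1)) (Fin (m + 1)) ℤ}
    (h : MinimalCorner H) : MinimalCorner Hᵀ := by
  refine ⟨h.1, fun U V hU hV => ?_⟩
  have e : (U * Hᵀ * V) 0 0 = (Vᵀ * H * Uᵀ) 0 0 := by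
    have : Vᵀ * H * Uᵀ = (U * Hᵀ * V)ᵀ := by simp [Matrix.mul_assoc]
    rw [this, Matrix.transpose_apply]
  rw [e]
  exact h.2 _ _ (by simpa using hV) (by simpa using hU)

theorem MinimalCorner.equiv {m : ℕ} {H U V : Matrix (Fin (m + 1)) (Fin (m + 1)) ℤ}
    (h : MinimalCorner H) (hU : IsUnit U) (hV : IsUnit V) (e : (U * H * V) 0 0 = H 0 0) :
    MinimalCorner (U * H * V) := by
  refine ⟨e ▸ h.1, fun U' V' hU' hV' h0 => ?_⟩
  have e' : U' * (U * H * V) * V' = (U' * U) * H * (V * V') := by simp only [Matrix.mul_assoc]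
  rw [e]
  rw [e'] at h0 ⊢
  exact h.2 _ _ (hU'.mul hU) (hV.mul hV') h0

/-- Otherwise one row operation and a swap put the nonzero remainder modulo the corner into the
corner, contradicting minimality. -/
theorem MinimalCorner.dvd_col {m : ℕ} {H : Matrix (Fin (m + 1)) (Fin (m + 1)) ℤ}
    (h : MinimalCorner H) (i : Fin m) : H 0 0 ∣ H i.succ 0 := by
  by_contra hn
  have e : (Matrix.swap ℤ 0 i.succ * bordered 1 0 (Pi.single i (-(H i.succ 0 / H 0 0))) 1 * H * 1 :
      Matrix (Fin (m + 1)) (Fin (m + 1)) ℤ) 0 0 = H i.succ 0 % H 0 0 := by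
    rw [Matrix.mul_one, Matrix.mul_assoc]
    rw [Matrix.swap_mul_apply_left]
    rw [eq_bordered H, bordered_mul]
    simp [bordered, Int.emod_def]
    ring
  have h1 := h.2 _ 1 ((isUnit_swapMatrix 0 i.succ).mul
    (isUnit_bordered_col (Pi.single i (-(H i.succ 0 / H 0 0))))) isUnit_one
  rw [e] at h1
  have h2 := h1 (fun h0 => hn (Int.dvd_of_emod_eq_zero h0))
  rw [abs_of_nonneg (Int.emod_nonneg _ h.1)] at h2
  exact absurd h2 (not_le.2 (Int.emod_lt_abs _ h.1))

theorem MinimalCorner.dvd_row {m : ℕ} {H : Matrix (Fin (m + 1)) (Fin (m + 1)) ℤ}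
    (h : MinimalCorner H) (j : Fin m) : H 0 0 ∣ H 0 j.succ := h.transpose.dvd_col j

/-- Adding a lower row to the first keeps the corner, hence its minimality, and brings the entries
of that row of `A` into the first row. -/
theorem MinimalCorner.dvd_block {m : ℕ} {g : ℤ} {A : Matrix (Fin m) (Fin m) ℤ}
    (h : MinimalCorner (bordered g 0 0 A)) (i j : Fin m) : g ∣ A i j := by
  have e : bordered 1 (Pi.single i 1) 0 1 * bordered g 0 0 A * 1 =
      bordered g (Pi.single i 1 ᵥ* A) 0 A := by
    rw [Matrix.mul_one, bordered_mul]; simp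
  have h' := h.equiv (isUnit_bordered_row (Pi.single i 1)) isUnit_one (by rw [e]; simp [bordered])
  rw [e] at h'
  simpa [bordered] using h'.dvd_row j

theorem exists_minimalCorner {m : ℕ} {G : Matrix (Fin (m + 1)) (Fin (m + 1)) ℤ} (hG : G ≠ 0) :
    ∃ U V : Matrix (Fin (m + 1)) (Fin (m + 1)) ℤ,
      IsUnit U ∧ IsUnit V ∧ MinimalCorner (U * G * V) := by
  let P : ℕ → Prop := fun k => ∃ U V : Matrix (Fin (m + 1)) (Fin (m + 1)) ℤ, IsUnit U ∧ IsUnit V ∧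
    (U * G * V) 0 0 ≠ 0 ∧ ((U * G * V) 0 0).natAbs = k
  have hP : ∃ k, P k := by
    obtain ⟨i, j, hij⟩ : ∃ i j, G i j ≠ 0 := by
      by_contra! h
      exact hG (Matrix.ext h)
    refine ⟨_, Matrix.swap ℤ 0 i, Matrix.swap ℤ j 0, isUnit_swapMatrix _ _, isUnit_swapMatrix _ _,
      ?_, rfl⟩
    rw [Matrix.mul_swap_apply_right, Matrix.swap_mul_apply_left]
    exact hij
  classical
  obtain ⟨U, V, hU, hV, h0, hk⟩ := Nat.find_spec hP
  refine ⟨U, V, hU, hV, h0, fun U' V' hU' hV' h' => ?_⟩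
  have e' : U' * (U * G * V) * V' = (U' * U) * G * (V * V') := by simp only [Matrix.mul_assoc]
  have := Nat.find_min' hP ⟨U' * U, V * V', hU'.mul hU, hV.mul hV', e' ▸ h', rfl⟩
  rw [← hk, ← e'] at this
  rw [Int.abs_eq_natAbs, Int.abs_eq_natAbs]
  exact_mod_cast this

theorem bordered_diagonal {m : ℕ} (x : ℤ) (d : Fin m → ℤ) :
    bordered x 0 0 (diagonal d) = diagonal (Fin.cons x d) := by
  ext i j
  refine Fin.cases ?_ (fun i => ?_) i <;> refine Fin.cases ?_ (fun j => ?_) j <;>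
    simp [bordered, diagonal_apply, Fin.succ_ne_zero, (Fin.succ_ne_zero _).symm]

/-- A minimal corner divides its row and column, which can be cleared, and then the whole remaining
block. Factoring it out of the block before recursing makes the divisibility chain automatic. -/
theorem exists_diagonal {m : ℕ} (G : Matrix (Fin m) (Fin m) ℤ) :
    ∃ (d : Fin m → ℤ) (U V : Matrix (Fin m) (Fin m) ℤ), (∀ i j, i ≤ j → d i ∣ d j) ∧
      IsUnit U ∧ IsUnit V ∧ U * G * V = diagonal d := by
  induction m with
  | zero => exact ⟨0, 1, 1, fun i => i.elim0, isUnit_one, isUnit_one, Matrix.ext fun i => i.elim0⟩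
  | succ m ih =>
    by_cases hG : G = 0
    · exact ⟨0, 1, 1, by simp, isUnit_one, isUnit_one, by simp [hG]⟩
    obtain ⟨U, V, hU, hV, hH⟩ := exists_minimalCorner hG
    set H := U * G * V with hHdef
    choose q hq using hH.dvd_col
    choose r hr using hH.dvd_row
    obtain ⟨B, hB⟩ : ∃ B : Matrix (Fin m) (Fin m) ℤ,
        bordered 1 0 (-q) 1 * H * bordered 1 (-r) 0 1 = bordered (H 0 0) 0 0 B := by
      have e1 : (fun j : Fin m => H 0 j.succ) = H 0 0 • r := funext hr
      have e2 : (fun j : Fin m => H j.succ 0) = H 0 0 • q := funext hq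
      have e3 : bordered 1 0 (-q) 1 * H = bordered (H 0 0) (H 0 0 • r) 0
          (vecMulVec (-q) (H 0 0 • r) + of fun i j : Fin m => H i.succ j.succ) := by
        conv_lhs => rw [eq_bordered H, e1, e2, bordered_mul]
        simp
      refine ⟨vecMulVec (-q) (H 0 0 • r) + of fun i j : Fin m => H i.succ j.succ, ?_⟩
      rw [e3, bordered_mul]
      simp
    have hmin : MinimalCorner (bordered (H 0 0) 0 0 B) := by
      rw [← hB]
      exact hH.equiv (isUnit_bordered_col _) (isUnit_bordered_row _)
        (by rw [hB]; simp [bordered])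
    obtain ⟨A, hBA⟩ : ∃ A : Matrix (Fin m) (Fin m) ℤ, B = H 0 0 • A := by
      choose A hA using hmin.dvd_block
      exact ⟨A, Matrix.ext fun i j => hA i j⟩
    obtain ⟨d, U', V', hd, hU', hV', e⟩ := ih A
    refine ⟨Fin.cons (H 0 0) (H 0 0 • d), bordered 1 0 0 U' * (bordered 1 0 (-q) 1 * U),
      V * bordered 1 (-r) 0 1 * bordered 1 0 0 V', ?_,
      (isUnit_bordered hU').mul ((isUnit_bordered_col _).mul hU),
      (hV.mul (isUnit_bordered_row _)).mul (isUnit_bordered hV'), ?_⟩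
    · intro i j
      refine Fin.cases ?_ (fun i => ?_) i <;> refine Fin.cases ?_ (fun j => ?_) j
      · simp
      · simp
      · simp
      · intro hij
        simpa using mul_dvd_mul_left _ (hd i j (by simpa using hij))
    · calc _ = bordered 1 0 0 U' * (bordered 1 0 (-q) 1 * H * bordered 1 (-r) 0 1) *
            bordered 1 0 0 V' := by simp only [hHdef, Matrix.mul_assoc]
        _ = _ := by
            rw [hB, hBA, bordered_mul, bordered_mul, ← bordered_diagonal, diagonal_smul, ← e]
            simp [-zsmul_eq_mul]

/-- The Smith normal form of a square integer matrix. -/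
theorem exists_isElementaryDivisors {m : ℕ} (G : Matrix (Fin m) (Fin m) ℤ) :
    ∃ d, IsElementaryDivisors G d := by
  obtain ⟨d, U, V, hd, hU, hV, e⟩ := exists_diagonal G
  let s : Fin m → ℤ := fun i => if 0 ≤ d i then 1 else -1
  have hs : diagonal s * diagonal s = 1 := by
    rw [diagonal_mul_diagonal, ← diagonal_one]
    congr 1
    ext i
    simp only [s]
    split_ifs <;> simp
  refine ⟨fun i => (d i).natAbs, fun i j hij => Int.natAbs_dvd_natAbs.2 (hd i j hij),
    (IsUnit.of_mul_eq_one _ hs).unit * hU.unit, hV.unit, ?_⟩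
  simp only [Units.val_mul, IsUnit.unit_spec]
  rw [Matrix.mul_assoc, Matrix.mul_assoc, ← Matrix.mul_assoc U, e, diagonal_mul_diagonal]
  congr 1
  ext i
  simp only [s]
  split_ifs with h
  · simp [abs_of_nonneg h]
  · simp [abs_of_neg (not_le.1 h)]

/-- A block with more than half of the rows and columns in total of an invertible integer matrix
has coprime entries. -/
theorem dvd_of_dvd_mul_block {ι κ : Type*} [Fintype ι] [Fintype κ] [DecidableEq κ]
    {W : Matrix ι κ ℤ} {W' : Matrix κ ι ℤ} (hW : W' * W = 1) (I : ι → Prop) (J : κ → Prop)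
    [DecidablePred I] [DecidablePred J]
    (hIJ : Fintype.card {i // ¬ I i} < Fintype.card {j // J j}) {y c : ℤ}
    (h : ∀ i j, I i → J j → y ∣ c * W i j) : y ∣ c := by
  -- The part of `W` outside the rows `I` and inside the columns `J` has more columns than rows,
  -- hence a nonzero kernel vector, which can be made primitive. Extended by zero, its image under
  -- `W` is supported on `I`.
  let φ : ({j // J j} → ℤ) →ₗ[ℤ] ({i // ¬ I i} → ℤ) :=
    (W.submatrix (fun i : {i // ¬ I i} => i.1) (fun j : {j // J j} => j.1)).mulVecLin
  have hφ : ¬ Function.Injective φ := fun hinj => by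
    have := LinearMap.finrank_le_finrank_of_injective hinj
    rw [Module.finrank_fintype_fun_eq_card, Module.finrank_fintype_fun_eq_card] at this
    exact absurd this (not_le.2 hIJ)
  obtain ⟨v, hv, hv0⟩ : ∃ v, φ v = 0 ∧ v ≠ 0 := by
    rw [← LinearMap.ker_eq_bot, Submodule.eq_bot_iff] at hφ
    push Not at hφ
    exact hφ
  obtain ⟨j0, hj0⟩ : ∃ j, v j ≠ 0 := by
    by_contra! hh
    exact hv0 (funext hh)
  obtain ⟨w, hw, hw1⟩ := Finset.extract_gcd v (⟨j0, Finset.mem_univ _⟩ : Finset.univ.Nonempty)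
  have hg : Finset.univ.gcd v ≠ 0 := fun h0 => hj0 (by rw [hw j0 (Finset.mem_univ _), h0, zero_mul])
  have hvw : v = Finset.univ.gcd v • w := funext fun j => by simpa using hw j (Finset.mem_univ _)
  have hw0 : φ w = 0 := by
    rw [hvw, map_smul] at hv
    exact (smul_eq_zero.1 hv).resolve_left hg
  let w' : κ → ℤ := fun j => if hj : J j then w ⟨j, hj⟩ else 0
  have hsum : ∀ i, (W *ᵥ w') i = ∑ j : {j // J j}, W i j * w j := fun i => by
    simp only [mulVec, dotProduct, w']
    rw [← Fintype.sum_subtype_add_sum_subtype J]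
    have h1 : ∀ x : {x // J x}, (if hj : J x.1 then w ⟨x, hj⟩ else 0) = w x := fun x => by
      rw [dif_pos x.2]
    have h2 : ∀ x : {x // ¬ J x}, (if hj : J x.1 then w ⟨x, hj⟩ else 0) = 0 := fun x => by
      rw [dif_neg x.2]
    simp only [h1, h2, mul_zero, Finset.sum_const_zero, add_zero]
  have hWw : ∀ i, y ∣ c * (W *ᵥ w') i := fun i => by
    by_cases hi : I i
    · rw [hsum, Finset.mul_sum]
      exact Finset.dvd_sum fun j _ => by
        rw [← mul_assoc]; exact (h i j hi j.2).mul_right _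
    · have := congrFun hw0 ⟨i, hi⟩
      simp only [φ, mulVecLin_apply, mulVec, dotProduct, submatrix_apply, Pi.zero_apply] at this
      rw [hsum, this]; simp
  -- The left inverse `W'` carries divisibility from the image back to the vector; primitivity then
  -- gives `y ∣ c`.
  have hyw : ∀ j, y ∣ c * w' j := fun j => by
    have : w' = W' *ᵥ (W *ᵥ w') := by rw [mulVec_mulVec, hW, one_mulVec]
    rw [this, mulVec, dotProduct, Finset.mul_sum]
    exact Finset.dvd_sum fun i _ => by
      rw [mul_left_comm]; exact (hWw i).mul_left _
  have : y ∣ Finset.univ.gcd fun j => c * w j := Finset.dvd_gcd fun j _ => by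
    simpa [w', j.2] using hyw j
  rw [Finset.gcd_mul_left, hw1, mul_one] at this
  exact (dvd_normalize_iff).1 this

/-- Entrywise, `d k * W k l * d' l = c * Z k l`. On the block `k ≥ i`, `l ≥ j` the left side is
divisible by `d i * d' j`; on the block `k ≤ i`, `l ≤ j` it divides `d i * d' j * W k l`. Each block
has `m + 1` rows and columns in total, just enough for `dvd_of_dvd_mul_block`. The sizes `m` and
`m'` are kept apart because the two ranks are only propositionally equal. -/
theorem mul_eq_of_diagonal_mul {m m' : ℕ} {W Z : Matrix (Fin m) (Fin m') ℤ}
    {W' Z' : Matrix (Fin m') (Fin m) ℤ} {d : Fin m → ℕ} {d' : Fin m' → ℕ} {c : ℕ}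
    (hd : ∀ i j, i ≤ j → d i ∣ d j) (hd' : ∀ i j, i ≤ j → d' i ∣ d' j)
    (hW : W' * W = 1) (hZ : Z' * Z = 1)
    (h : diagonal (fun i => (d i : ℤ)) * W * diagonal (fun i => (d' i : ℤ)) = (c : ℤ) • Z)
    (hmm : m' = m) (i : Fin m) (j : Fin m') (hij : (i : ℕ) + 1 + (j + 1) = m + 1) :
    d i * d' j = c := by
  have h' : ∀ k l, (d k : ℤ) * W k l * d' l = c * Z k l := fun k l => by
    have := congrFun (congrFun h k) l
    simpa [mul_diagonal, diagonal_mul] using this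
  subst hmm
  have card_lt : ∀ i : Fin m', Fintype.card {k : Fin m' // k < i} = i := fun i => by
    rw [Fintype.card_of_subtype (Finset.Iio i) (by simp)]; simp
  have card_le : ∀ i : Fin m', Fintype.card {k : Fin m' // k ≤ i} = i + 1 := fun i => by
    rw [Fintype.card_of_subtype (Finset.Iic i) (by simp)]; simp
  have card_gt : ∀ i : Fin m', Fintype.card {k : Fin m' // i < k} = m' - 1 - i := fun i => by
    rw [Fintype.card_of_subtype (Finset.Ioi i) (by simp)]; simp
  have card_ge : ∀ i : Fin m', Fintype.card {k : Fin m' // i ≤ k} = m' - i := fun i => by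
    rw [Fintype.card_of_subtype (Finset.Ici i) (by simp)]; simp
  apply Nat.dvd_antisymm
  · rw [← Int.natCast_dvd_natCast]
    refine dvd_of_dvd_mul_block hZ (fun k => i ≤ k) (fun l => j ≤ l) ?_ fun k l hk hl => ?_
    · simp only [not_le]
      rw [card_lt, card_ge]; omega
    · rw [← h', Nat.cast_mul, mul_right_comm]
      exact (mul_dvd_mul (by exact_mod_cast hd _ _ hk) (by exact_mod_cast hd' _ _ hl)).mul_right _
  · rw [← Int.natCast_dvd_natCast]
    refine dvd_of_dvd_mul_block hW (fun k => k ≤ i) (fun l => l ≤ j) ?_ fun k l hk hl => ?_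
    · simp only [not_le]
      rw [card_gt, card_le]; omega
    · refine (Dvd.intro _ (h' k l).symm).trans ?_
      rw [Nat.cast_mul, mul_right_comm]
      exact mul_dvd_mul_right (mul_dvd_mul (by exact_mod_cast hd _ _ hk)
        (by exact_mod_cast hd' _ _ hl)) _

end ElementaryDivisors

end Specht

namespace Specht

open Matrix

/-! ### Lattices spanned by the columns of a left invertible matrix, and their Gram matrices. -/

section GramMatrices

instance (n : ℕ) (μ : YoungDiagram) : Finite (Tabloid n μ) :=
  inferInstanceAs (Finite (Quotient (Tableau.rowSetoid n μ)))

noncomputable instance (n : ℕ) (μ : YoungDiagram) : Fintype (Tabloid n μ) := Fintype.ofFinite _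

open Classical in
noncomputable instance (n : ℕ) (μ : YoungDiagram) : DecidableEq (Tabloid n μ) := inferInstance

theorem form_apply {n : ℕ} {μ : YoungDiagram} (x y : PermModule n μ) :
    form n μ x y = ∑ s, x s * y s := by
  simp [form, Finsupp.linearCombination_apply, Finsupp.sum_fintype]

variable {A F : Type*} [Fintype A] [Fintype F] [DecidableEq F]

/-- A lattice of integer functions spanned by the columns of a matrix with a left inverse. -/
theorem exists_equiv_of_span {T : Type*} {e : T → A →₀ ℤ} {P : Matrix A F ℤ}
    {L : Matrix F A ℤ} (hLP : L * P = 1) (he : ∀ t, ∃ v, ⇑(e t) = P *ᵥ v)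
    (hP : ∀ f, ∃ x ∈ Submodule.span ℤ (Set.range e), ⇑x = P.col f) :
    ∃ E : Submodule.span ℤ (Set.range e) ≃ₗ[ℤ] (F → ℤ),
      ∀ x : Submodule.span ℤ (Set.range e), ⇑(x : A →₀ ℤ) = P *ᵥ E x := by
  have hspan : ∀ x ∈ Submodule.span ℤ (Set.range e), ∃ v, ⇑x = P *ᵥ v := fun x hx => by
    induction hx using Submodule.span_induction with
    | mem x hx => obtain ⟨t, rfl⟩ := hx; exact he t
    | zero => exact ⟨0, by simp⟩
    | add x y _ _ hx hy =>
      obtain ⟨v, hv⟩ := hx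
      obtain ⟨w, hw⟩ := hy
      exact ⟨v + w, by rw [Finsupp.coe_add, hv, hw, mulVec_add]⟩
    | smul c x _ hx =>
      obtain ⟨v, hv⟩ := hx
      exact ⟨c • v, by rw [Finsupp.coe_smul, hv, mulVec_smul]⟩
  -- `P * L` is a projection fixing the lattice, so `x ↦ L *ᵥ x` reads off coordinates.
  have hPL : ∀ x ∈ Submodule.span ℤ (Set.range e), P *ᵥ (L *ᵥ ⇑x) = ⇑x := fun x hx => by
    obtain ⟨v, hv⟩ := hspan x hx
    rw [hv, mulVec_mulVec v L P, hLP, one_mulVec]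
  choose p hp hpP using hP
  have hsum : ∀ v : F → ℤ, ⇑(∑ f, v f • p f) = P *ᵥ v := fun v => by
    ext s
    simp [Finsupp.finsetSum_apply, hpP, mulVec, dotProduct, mul_comm]
  refine ⟨LinearEquiv.ofBijective
    { toFun := fun x : Submodule.span ℤ (Set.range e) => L *ᵥ ⇑(x : A →₀ ℤ)
      map_add' := fun x y => by simp [mulVec_add]
      map_smul' := fun c x => by simp [mulVec_smul, -zsmul_eq_mul] } ⟨fun x y hxy => ?_, fun v => ?_⟩,
    fun x => (hPL x x.2).symm⟩
  · have hxy' : L *ᵥ ⇑(x : A →₀ ℤ) = L *ᵥ ⇑(y : A →₀ ℤ) := hxy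
    apply Subtype.ext
    apply DFunLike.coe_injective
    rw [← hPL x x.2, hxy', hPL y y.2]
  · refine ⟨⟨∑ f, v f • p f, Submodule.sum_mem _ fun f _ => Submodule.smul_mem _ _ (hp f)⟩, ?_⟩
    change L *ᵥ ⇑(∑ f, v f • p f) = v
    rw [hsum, mulVec_mulVec, hLP, one_mulVec]

variable {n : ℕ} {μ : YoungDiagram}

/-- Change of basis: `g` holds the `E`-coordinates of `b`. It is formally rectangular, so its
invertibility is recorded by a two-sided inverse. -/
theorem gramMatrix_eq {m : ℕ} {P : Matrix (Tabloid n μ) F ℤ}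
    (E : spechtModule n μ ≃ₗ[ℤ] (F → ℤ))
    (hE : ∀ x : spechtModule n μ, ⇑(x : PermModule n μ) = P *ᵥ E x)
    (b : Module.Basis (Fin m) ℤ (spechtModule n μ)) :
    ∃ (g : Matrix F (Fin m) ℤ) (g' : Matrix (Fin m) F ℤ), g * g' = 1 ∧ g' * g = 1 ∧
      gramMatrix b = gᵀ * (Pᵀ * P) * g := by
  refine ⟨(Pi.basisFun ℤ F).toMatrix (b.map E), (b.map E).toMatrix (Pi.basisFun ℤ F),
    Module.Basis.toMatrix_mul_toMatrix_flip _ _, Module.Basis.toMatrix_mul_toMatrix_flip _ _, ?_⟩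
  set g := (Pi.basisFun ℤ F).toMatrix (b.map E)
  have hg : ∀ i s, (b i : PermModule n μ) s = (P * g) s i := fun i s => by
    rw [hE]
    rfl
  ext i j
  rw [gramMatrix, of_apply, form_apply, ← Matrix.mul_assoc, ← transpose_mul, Matrix.mul_assoc,
    mul_apply]
  simp only [transpose_apply, hg]

/-- Two matrices whose product is the scalar `c`, taken up to congruence, have complementary
elementary divisors. -/
theorem elementaryDivisors_mul_eq {m m' : ℕ} {X Y : Matrix F F ℤ} {c : ℕ}
    (hXY : X * Y = (c : ℤ) • 1) {g : Matrix F (Fin m) ℤ} {g' : Matrix (Fin m) F ℤ}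
    {h : Matrix F (Fin m') ℤ} {h' : Matrix (Fin m') F ℤ}
    (hg : g * g' = 1) (hh : h * h' = 1) (hh' : h' * h = 1) (hmm : m' = m)
    {d : Fin m → ℕ} {d' : Fin m' → ℕ}
    (hd : IsElementaryDivisors (gᵀ * X * g) d) (hd' : IsElementaryDivisors (hᵀ * Y * h) d')
    (i : Fin m) (j : Fin m') (hij : (i : ℕ) + 1 + (j + 1) = m + 1) :
    d i * d' j = c := by
  obtain ⟨hdiv, U, V, hUV⟩ := hd
  obtain ⟨hdiv', U', V', hUV'⟩ := hd'
  have tg : g'ᵀ * gᵀ = 1 := by rw [← transpose_mul, hg, transpose_one]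
  have th : h'ᵀ * hᵀ = 1 := by rw [← transpose_mul, hh, transpose_one]
  have th' : hᵀ * h'ᵀ = 1 := by rw [← transpose_mul, hh', transpose_one]
  -- `W` undoes the factors `g * V` and `U' * hᵀ` that stand between `X` and `Y` in the product of
  -- the two diagonal forms; what remains is `U * gᵀ * (X * Y) * h * V'`, that is `c • Z`.
  refine mul_eq_of_diagonal_mul hdiv hdiv'
    (W := (V⁻¹).val * g' * h'ᵀ * (U'⁻¹).val)
    (W' := U'.val * hᵀ * g * V.val)
    (Z := U.val * gᵀ * h * V'.val)
    (Z' := (V'⁻¹).val * h' * g'ᵀ * (U⁻¹).val) ?_ ?_ ?_ hmm i j hij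
  · have : U'.val * hᵀ * g * V.val *
        ((V⁻¹).val * g' * h'ᵀ * (U'⁻¹).val) =
        U'.val * (hᵀ * (g * (V.val * (V⁻¹).val) * g') * h'ᵀ) *
          (U'⁻¹).val := by simp only [Matrix.mul_assoc]
    rw [this, Units.mul_inv, Matrix.mul_one, hg, Matrix.mul_one, th', Matrix.mul_one,
      Units.mul_inv]
  · have : (V'⁻¹).val * h' * g'ᵀ * (U⁻¹).val *
        (U.val * gᵀ * h * V'.val) =
        (V'⁻¹).val * (h' * (g'ᵀ * ((U⁻¹).val * U.val) * gᵀ) * h) *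
          V'.val := by simp only [Matrix.mul_assoc]
    rw [this, Units.inv_mul, Matrix.mul_one, tg, Matrix.mul_one, hh', Matrix.mul_one,
      Units.inv_mul]
  · have : U.val * (gᵀ * X * g) * V.val *
        ((V⁻¹).val * g' * h'ᵀ * (U'⁻¹).val) *
        (U'.val * (hᵀ * Y * h) * V'.val) =
        U.val * gᵀ * (X * (g * (V.val * (V⁻¹).val) * g') *
          (h'ᵀ * ((U'⁻¹).val * U'.val) * hᵀ) * Y) * h *
          V'.val := by simp only [Matrix.mul_assoc]
    rw [← hUV, ← hUV', this, Units.mul_inv, Units.inv_mul, Matrix.mul_one, Matrix.mul_one, hg, th,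
      Matrix.mul_one, Matrix.mul_one, hXY, Matrix.mul_smul, Matrix.mul_one, Matrix.smul_mul,
      Matrix.smul_mul]

end GramMatrices

end Specht

namespace Specht

/-! ### Combinatorics of tableaux: rows, columns and weights. -/

namespace Tableau

variable {n : ℕ} {μ : YoungDiagram}

theorem mem (a : Tableau n μ) (k : Fin n) : (a.row k, a.col k) ∈ μ := (a.symm k).2

theorem eq_of_row_col (a : Tableau n μ) {k l : Fin n} (hr : a.row k = a.row l)
    (hc : a.col k = a.col l) : k = l :=
  a.symm.injective (Subtype.ext (Prod.ext hr hc))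

theorem ext_row_col {a b : Tableau n μ} (hr : a.row = b.row) (hc : a.col = b.col) : a = b := by
  rw [← Equiv.symm_symm a, ← Equiv.symm_symm b]
  exact congrArg _ (Equiv.ext fun k =>
    Subtype.ext (Prod.ext (congrFun hr k) (congrFun hc k)))

theorem exists_row_col (a : Tableau n μ) {i j : ℕ} (h : (i, j) ∈ μ) :
    ∃ k, a.row k = i ∧ a.col k = j :=
  ⟨a ⟨(i, j), h⟩, by simp [row], by simp [col]⟩

theorem row_permute (a : Tableau n μ) (σ : Equiv.Perm (Fin n)) (k : Fin n) :
    (a.permute σ).row k = a.row (σ.symm k) := rfl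

theorem col_permute (a : Tableau n μ) (σ : Equiv.Perm (Fin n)) (k : Fin n) :
    (a.permute σ).col k = a.col (σ.symm k) := rfl

theorem permute_symm_trans (a b : Tableau n μ) : a.permute (a.symm.trans b) = b := by
  ext; simp [permute]

theorem symm_trans_permute (a : Tableau n μ) (σ : Equiv.Perm (Fin n)) :
    a.symm.trans (a.permute σ) = σ := by
  ext; simp [permute]

theorem card_row_eq_col_lt (a : Tableau n μ) (i j : ℕ) :
    (Finset.univ.filter fun k => a.row k = i ∧ a.col k < j).card = min (μ.rowLen i) j := by
  rw [← Finset.card_range (min _ _)]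
  refine Finset.card_nbij a.col (fun k hk => ?_) (fun k hk l hl h => ?_) fun c hc => ?_
  · simp only [Finset.coe_filter, Finset.mem_univ, true_and, Set.mem_ofPred_eq] at hk
    have := YoungDiagram.mem_iff_lt_rowLen.1 (a.mem k)
    simp only [Finset.coe_range, Set.mem_Iio, lt_min_iff]
    exact ⟨hk.1 ▸ this, hk.2⟩
  · simp only [Finset.coe_filter, Finset.mem_univ, true_and, Set.mem_ofPred_eq] at hk hl
    exact a.eq_of_row_col (hk.1.trans hl.1.symm) h
  · simp only [Finset.coe_range, Set.mem_Iio, lt_min_iff] at hc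
    obtain ⟨k, hk, hk'⟩ := a.exists_row_col (YoungDiagram.mem_iff_lt_rowLen.2 hc.1)
    exact ⟨k, by simpa [hk, hk'] using hc.2, hk'⟩

theorem card_col_eq_row_lt (a : Tableau n μ) (i j : ℕ) :
    (Finset.univ.filter fun k => a.col k = j ∧ a.row k < i).card = min (μ.colLen j) i := by
  rw [← Finset.card_range (min _ _)]
  refine Finset.card_nbij a.row (fun k hk => ?_) (fun k hk l hl h => ?_) fun c hc => ?_
  · simp only [Finset.coe_filter, Finset.mem_univ, true_and, Set.mem_ofPred_eq] at hk
    have := YoungDiagram.mem_iff_lt_colLen.1 (a.mem k)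
    simp only [Finset.coe_range, Set.mem_Iio, lt_min_iff]
    exact ⟨hk.1 ▸ this, hk.2⟩
  · simp only [Finset.coe_filter, Finset.mem_univ, true_and, Set.mem_ofPred_eq] at hk hl
    exact a.eq_of_row_col h (hk.1.trans hl.1.symm)
  · simp only [Finset.coe_range, Set.mem_Iio, lt_min_iff] at hc
    obtain ⟨k, hk, hk'⟩ := a.exists_row_col (YoungDiagram.mem_iff_lt_colLen.2 hc.1)
    exact ⟨k, by simpa [hk, hk'] using hc.2, hk⟩

theorem row_lt (a : Tableau n μ) (k : Fin n) : a.row k < μ.colLen (a.col k) :=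
  YoungDiagram.mem_iff_lt_colLen.1 (a.mem k)

theorem col_lt (a : Tableau n μ) (k : Fin n) : a.col k < μ.rowLen (a.row k) :=
  YoungDiagram.mem_iff_lt_rowLen.1 (a.mem k)

/-- If each row of `a` meets each column of `b` in at most one letter, then some tableau has the
rows of `a` and the columns of `b`. -/
theorem exists_row_eq_col_eq (a b : Tableau n μ)
    (h : ∀ k l, a.row k = a.row l → b.col k = b.col l → k = l) :
    ∃ c : Tableau n μ, c.row = a.row ∧ c.col = b.col := by
  have hmem : ∀ k, (a.row k, b.col k) ∈ μ := fun k => by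
    rw [YoungDiagram.mem_iff_lt_rowLen]
    set j := μ.rowLen (a.row k) with hj
    let R := Finset.univ.image a.row
    -- The first `j` columns of `b` meet row `i` of `a` in at most `min (μ.rowLen i) j` letters, the
    -- number attained by `a` itself.
    have hle : ∀ i ∈ R, (Finset.univ.filter fun l => a.row l = i ∧ b.col l < j).card ≤
        (Finset.univ.filter fun l => a.row l = i ∧ a.col l < j).card := fun i _ => by
      rw [card_row_eq_col_lt]
      refine le_min ?_ ?_
      · refine (Finset.card_le_card (t := Finset.univ.filter fun l => a.row l = i ∧
          a.col l < μ.rowLen i) fun l hl => ?_).trans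
            ((a.card_row_eq_col_lt i _).trans_le (min_le_left _ _))
        simp only [Finset.mem_filter, Finset.mem_univ, true_and] at hl ⊢
        exact ⟨hl.1, hl.1 ▸ a.col_lt l⟩
      · rw [← Finset.card_range j]
        refine Finset.card_le_card_of_injOn b.col (fun l hl => ?_) fun l hl m hm hlm => ?_
        · simp at hl ⊢; exact hl.2
        · simp at hl hm
          exact h l m (hl.1.trans hm.1.symm) hlm
    have hfib : ∀ c : Tableau n μ, ∑ i ∈ R, (Finset.univ.filter fun l => a.row l = i ∧
        c.col l < j).card = (Finset.univ.filter fun l => c.col l < j).card := fun c => by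
      rw [Finset.card_eq_sum_card_fiberwise (f := a.row) (t := R) (fun l _ => by simp [R])]
      refine Finset.sum_congr rfl fun i _ => ?_
      rw [Finset.filter_filter]
      simp only [and_comm]
    have hcard : (Finset.univ.filter fun l => b.col l < j).card =
        (Finset.univ.filter fun l => a.col l < j).card := by
      refine Finset.card_equiv (b.symm.trans a) fun l => ?_
      simp only [Finset.mem_filter, Finset.mem_univ, true_and]
      simp [col]
    -- Summed over all rows the two counts agree, so they agree in each row. As `j` is the length of
    -- the row of `k`, that whole row lies in the first `j` columns of `b`.
    have heq := (Finset.sum_eq_sum_iff_of_le hle).1 (by rw [hfib, hfib, hcard]) (a.row k)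
      (by simp [R])
    have hsub : (Finset.univ.filter fun l => a.row l = a.row k ∧ b.col l < j) ⊆
        (Finset.univ.filter fun l => a.row l = a.row k ∧ a.col l < j) := fun l hl => by
      simp only [Finset.mem_filter, Finset.mem_univ, true_and] at hl ⊢
      exact ⟨hl.1, by rw [hj, ← hl.1]; exact a.col_lt l⟩
    have hk : k ∈ Finset.univ.filter fun l => a.row l = a.row k ∧ a.col l < j := by
      simpa using a.col_lt k
    rw [← Finset.eq_of_subset_of_card_le hsub heq.ge] at hk
    simpa using hk
  have hbij : Function.Bijective
      (fun k => (⟨(a.row k, b.col k), hmem k⟩ : {c : ℕ × ℕ // c ∈ μ.cells})) := by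
    rw [Fintype.bijective_iff_injective_and_card]
    refine ⟨fun k l hkl => ?_, (Fintype.card_congr a).symm⟩
    simp only [Subtype.mk.injEq, Prod.mk.injEq] at hkl
    exact h k l hkl.1 hkl.2
  refine ⟨(Equiv.ofBijective _ hbij).symm, ?_, ?_⟩
  · ext k; simp [row]
  · ext k; simp [col]

/-- The entries increase down the columns. -/
def ColIncreasing (a : Tableau n μ) : Prop := ∀ k l, a.col k = a.col l → a.row k < a.row l → k < l

/-- The entries increase along the rows. -/
def RowIncreasing (a : Tableau n μ) : Prop := ∀ k l, a.row k = a.row l → a.col k < a.col l → k < l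

/-- In an increasing column the row of a letter counts the smaller letters there; so a column
increasing tableau is determined by its columns. -/
theorem ColIncreasing.row_eq {a : Tableau n μ} (ha : a.ColIncreasing) (k : Fin n) :
    a.row k = (Finset.univ.filter fun l => a.col l = a.col k ∧ l < k).card := by
  rw [← (a.card_col_eq_row_lt (a.row k) (a.col k)).trans (min_eq_right (a.row_lt k).le)]
  congr 1
  ext l
  simp only [Finset.mem_filter, Finset.mem_univ, true_and, and_congr_right_iff]
  refine fun hl => ⟨ha l k hl, fun hlk => ?_⟩
  rcases lt_trichotomy (a.row l) (a.row k) with h | h | h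
  · exact h
  · exact absurd (a.eq_of_row_col h hl) hlk.ne
  · exact absurd (ha k l hl.symm h) hlk.not_gt

theorem RowIncreasing.col_eq {a : Tableau n μ} (ha : a.RowIncreasing) (k : Fin n) :
    a.col k = (Finset.univ.filter fun l => a.row l = a.row k ∧ l < k).card := by
  rw [← (a.card_row_eq_col_lt (a.row k) (a.col k)).trans (min_eq_right (a.col_lt k).le)]
  congr 1
  ext l
  simp only [Finset.mem_filter, Finset.mem_univ, true_and, and_congr_right_iff]
  refine fun hl => ⟨ha l k hl, fun hlk => ?_⟩
  rcases lt_trichotomy (a.col l) (a.col k) with h | h | h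
  · exact h
  · exact absurd (a.eq_of_row_col hl h) hlk.ne
  · exact absurd (ha k l hl.symm h) hlk.not_gt

theorem ColIncreasing.eq {a b : Tableau n μ} (ha : a.ColIncreasing) (hb : b.ColIncreasing)
    (h : a.col = b.col) : a = b :=
  ext_row_col (funext fun k => by rw [ha.row_eq, hb.row_eq, h]) h

theorem RowIncreasing.eq {a b : Tableau n μ} (ha : a.RowIncreasing) (hb : b.RowIncreasing)
    (h : a.row = b.row) : a = b :=
  ext_row_col h (funext fun k => by rw [ha.col_eq, hb.col_eq, h])

/-- Rearrangement inequality: letters of `Z` placed oppositely to `f` minimize the sum, strictly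
once `π` breaks the opposite order at some pair. -/
theorem sum_mul_lt_of_antivary {f : Fin n → ℕ} {Z : Finset (Fin n)} {π : Equiv.Perm (Fin n)}
    (hπ : ∀ k, k ∉ Z → π k = k) (hf : ∀ k ∈ Z, ∀ l ∈ Z, f k < f l → l < k) {k l : Fin n}
    (hk : k ∈ Z) (hl : l ∈ Z) (hkl : f k < f l) (hπkl : π k < π l) :
    ∑ m : Fin n, (m : ℕ) * f m < ∑ m : Fin n, (π m : ℕ) * f m := by
  rw [← Finset.sum_add_sum_compl Z, ← Finset.sum_add_sum_compl Z fun m => (π m : ℕ) * f m]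
  have hc : ∑ m ∈ Zᶜ, (π m : ℕ) * f m = ∑ m ∈ Zᶜ, (m : ℕ) * f m :=
    Finset.sum_congr rfl fun m hm => by rw [hπ m (by simpa using hm)]
  rw [hc, add_lt_add_iff_right]
  refine (AntivaryOn.sum_mul_lt_sum_comp_perm_mul_iff (s := Z)
    (f := fun m : Fin n => (m : ℕ)) (g := f) (σ := π)
    (fun k hk l hl h => (Fin.le_def.1 (hf k hk l hl h).le)) fun m hm => ?_).2 fun h => ?_
  · by_contra hmZ
    exact hm (hπ m hmZ)
  · exact absurd (h hk hl hkl) (not_le.2 hπkl)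

/-- The letters, weighted by their rows. -/
def rowWeight (a : Tableau n μ) : ℕ := ∑ k : Fin n, (k : ℕ) * a.row k

/-- The letters, weighted by their columns. -/
def colWeight (a : Tableau n μ) : ℕ := ∑ k : Fin n, (k : ℕ) * a.col k

theorem rowWeight_permute (a : Tableau n μ) (π : Equiv.Perm (Fin n)) :
    (a.permute π).rowWeight = ∑ k : Fin n, (π k : ℕ) * a.row k := by
  rw [rowWeight, ← Equiv.sum_comp π]
  simp [row_permute]

theorem colWeight_permute (a : Tableau n μ) (π : Equiv.Perm (Fin n)) :
    (a.permute π).colWeight = ∑ k : Fin n, (π k : ℕ) * a.col k := by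
  rw [colWeight, ← Equiv.sum_comp π]
  simp [col_permute]

theorem colIncreasing_of_rowWeight_max {a : Tableau n μ}
    (h : ∀ b : Tableau n μ, b.col = a.col → b.rowWeight ≤ a.rowWeight) : a.ColIncreasing := by
  intro k l hc hr
  by_contra hkl
  have hne : k ≠ l := fun e => by simp [e] at hr
  have hlk : l < k := lt_of_le_of_ne (not_lt.1 hkl) hne.symm
  have hcol : (a.permute (Equiv.swap k l)).col = a.col := funext fun m => by
    rw [col_permute, Equiv.symm_swap, Equiv.swap_apply_def]
    split_ifs with h1 h2
    · rw [h1, hc]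
    · rw [h2, hc]
    · rfl
  refine absurd (h _ hcol) (not_le.2 ?_)
  rw [rowWeight_permute]
  refine sum_mul_lt_of_antivary (Z := {k, l}) (fun m hm => ?_) ?_ (k := k) (l := l) (by simp)
    (by simp) hr (by rwa [Equiv.swap_apply_left, Equiv.swap_apply_right])
  · simp only [Finset.mem_insert, Finset.mem_singleton, not_or] at hm
    exact Equiv.swap_apply_of_ne_of_ne hm.1 hm.2
  · intro x hx y hy hxy
    simp only [Finset.mem_insert, Finset.mem_singleton] at hx hy
    rcases hx with rfl | rfl <;> rcases hy with rfl | rfl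
    · exact absurd hxy (lt_irrefl _)
    · exact hlk
    · exact absurd hxy hr.not_gt
    · exact absurd hxy (lt_irrefl _)

theorem exists_colIncreasing_max (a : Tableau n μ) : ∃ b : Tableau n μ, b.col = a.col ∧
    b.ColIncreasing ∧ ∀ c : Tableau n μ, c.col = a.col → c.rowWeight ≤ b.rowWeight := by
  obtain ⟨b, hb, hmax⟩ := Finset.exists_max_image
    (Finset.univ.filter fun b : Tableau n μ => b.col = a.col) rowWeight ⟨a, by simp⟩
  simp only [Finset.mem_filter, Finset.mem_univ, true_and] at hb hmax
  exact ⟨b, hb, colIncreasing_of_rowWeight_max fun c hc => hmax c (hc.trans hb), hmax⟩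

/-- A maximizer of the row weight in a column class is column increasing, since swapping an
inversion raises the weight, and there is only one such tableau. -/
theorem ColIncreasing.eq_or_rowWeight_lt {a b : Tableau n μ} (ha : a.ColIncreasing)
    (h : b.col = a.col) : b = a ∨ b.rowWeight < a.rowWeight := by
  obtain ⟨c, hc, hci, hmax⟩ := a.exists_colIncreasing_max
  obtain rfl := hci.eq ha hc
  rcases (hmax b h).lt_or_eq with hlt | heq
  · exact Or.inr hlt
  · exact Or.inl ((colIncreasing_of_rowWeight_max fun d hd => heq ▸ hmax d (hd.trans h)).eq ha h)

end Tableau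

/-! ### Polytabloids, Garnir relations and straightening. -/

variable {n : ℕ} {μ : YoungDiagram}

open Equiv.Perm (sign)

theorem tabloid_eq_iff {a b : Tableau n μ} : tabloid a = tabloid b ↔ a.row = b.row :=
  Quotient.eq.trans funext_iff.symm

theorem sign_symm_trans_mul (a b c : Tableau n μ) :
    sign (a.symm.trans b) * sign (b.symm.trans c) = sign (a.symm.trans c) := by
  rw [mul_comm, ← Equiv.Perm.sign_mul]
  congr 1
  ext; simp

theorem sign_symm_trans_comm (a b : Tableau n μ) :
    sign (a.symm.trans b) = sign (b.symm.trans a) := by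
  rw [← Equiv.Perm.sign_symm]
  rfl

/-- Replaces the column stabilizer by the column class, through `σ ↦ a.permute σ`. -/
theorem polytabloid_eq_sum (a : Tableau n μ) :
    polytabloid a = ∑ b : Tableau n μ with b.col = a.col,
      (sign (a.symm.trans b) : ℤ) • Finsupp.single (tabloid b) 1 := by
  classical
  rw [polytabloid]
  refine Finset.sum_bij (fun (σ : a.colStabilizer) _ => a.permute σ) (fun σ _ => ?_)
    (fun σ _ τ _ h => ?_)
    (fun b hb => ?_) fun σ _ => ?_
  · simp only [Finset.mem_filter, Finset.mem_univ, true_and]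
    funext k
    rw [Tableau.col_permute]
    exact (a.colStabilizer.inv_mem σ.2) k
  · apply Subtype.ext
    rw [← a.symm_trans_permute σ, h, a.symm_trans_permute]
  · simp only [Finset.mem_filter, Finset.mem_univ, true_and] at hb
    refine ⟨⟨a.symm.trans b, fun k => ?_⟩, Finset.mem_univ _, a.permute_symm_trans b⟩
    rw [← hb]
    simp [Tableau.col]
    rw [← Tableau.col, ← Tableau.col, hb]
  · rw [a.symm_trans_permute]

theorem polytabloid_permute (a : Tableau n μ) (π : Equiv.Perm (Fin n)) :
    polytabloid (a.permute π) = ∑ b : Tableau n μ with b.col = a.col,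
      (sign (a.symm.trans b) : ℤ) • Finsupp.single (tabloid (b.permute π)) 1 := by
  rw [polytabloid_eq_sum]
  symm
  refine Finset.sum_bij (fun b _ => b.permute π) (fun b hb => ?_) (fun b _ c _ h => ?_)
    (fun b hb => ?_) fun b _ => ?_
  · simp only [Finset.mem_filter, Finset.mem_univ, true_and] at hb ⊢
    funext k
    rw [Tableau.col_permute, hb, Tableau.col_permute]
  · ext x
    have := congrArg (fun t : Tableau n μ => t x) h
    simpa [Tableau.permute, Fin.ext_iff] using this
  · simp only [Finset.mem_filter, Finset.mem_univ, true_and] at hb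
    refine ⟨b.permute π.symm, ?_, by ext; simp [Tableau.permute]⟩
    simp only [Finset.mem_filter, Finset.mem_univ, true_and]
    funext k
    rw [Tableau.col_permute, hb, Tableau.col_permute]
    simp
  · have : (a.permute π).symm.trans (b.permute π) = π * (a.symm.trans b) * π⁻¹ := by
      ext; simp [Tableau.permute, Equiv.Perm.mul_def]
    rw [this, Equiv.Perm.sign_mul, Equiv.Perm.sign_mul, Equiv.Perm.sign_inv, mul_right_comm,
      Int.units_mul_self, one_mul]

theorem polytabloid_of_col_eq {a b : Tableau n μ} (h : b.col = a.col) :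
    polytabloid b = (sign (a.symm.trans b) : ℤ) • polytabloid a := by
  rw [polytabloid_eq_sum, polytabloid_eq_sum, h, Finset.smul_sum]
  refine Finset.sum_congr rfl fun c _ => ?_
  rw [smul_smul, ← Units.val_mul, sign_symm_trans_comm a b, sign_symm_trans_mul]

/-- For each `b`, composing `π` with the swap of two letters of `Z` in one row of `b` keeps the
tabloid and flips the sign. The sum is over all permutations of `Z`, not coset representatives, so
polytabloids may repeat. -/
theorem sum_sign_smul_polytabloid (a : Tableau n μ) (Z : Finset (Fin n))
    (hZ : ∀ b : Tableau n μ, b.col = a.col → ∃ k ∈ Z, ∃ l ∈ Z, k ≠ l ∧ b.row k = b.row l) :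
    ∑ π : Equiv.Perm (Fin n) with ∀ k, k ∉ Z → π k = k,
      (sign π : ℤ) • polytabloid (a.permute π) = 0 := by
  simp_rw [polytabloid_permute, Finset.smul_sum]
  rw [Finset.sum_comm]
  refine Finset.sum_eq_zero fun b hb => ?_
  simp only [Finset.mem_filter, Finset.mem_univ, true_and] at hb
  obtain ⟨k, hk, l, hl, hkl, hrow⟩ := hZ b hb
  refine Finset.sum_involution (fun π _ => π * Equiv.swap k l) (fun π _ => ?_) (fun π _ _ => ?_)
    (fun π hπ => ?_) (fun π _ => ?_)
  · have : tabloid (b.permute (π * Equiv.swap k l)) = tabloid (b.permute π) := by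
      rw [tabloid_eq_iff]
      funext m
      rw [Tableau.row_permute, Tableau.row_permute]
      change b.row (Equiv.swap k l (π.symm m)) = _
      rw [Equiv.swap_apply_def]
      split_ifs with h1 h2
      · rw [h1, hrow]
      · rw [h2, hrow]
      · rfl
    rw [this, Equiv.Perm.sign_mul, Equiv.Perm.sign_swap hkl]
    simp
  · intro h
    exact hkl (Equiv.swap_eq_one_iff.1 (mul_eq_left.1 h))
  · simp only [Finset.mem_filter, Finset.mem_univ, true_and] at hπ ⊢
    intro m hm
    rw [Equiv.Perm.mul_apply, Equiv.swap_apply_of_ne_of_ne (fun e : m = k => hm (e ▸ hk))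
      (fun e : m = l => hm (e ▸ hl)), hπ m hm]
  · simp [mul_assoc]

theorem exists_mem_apply_notMem {α : Type*} [DecidableEq α] (π : Equiv.Perm α) {X : Finset α}
    {y : α} (hy : y ∉ X) (hπ : π y ∈ X) : ∃ x ∈ X, π x ∉ X := by
  by_contra! h
  have : X.image π = X := Finset.eq_of_subset_of_card_le (Finset.image_subset_iff.2 h)
    (Finset.card_image_of_injective _ π.injective).ge
  rw [← this] at hπ
  obtain ⟨x, hx, e⟩ := Finset.mem_image.1 hπ
  exact hy (π.injective e ▸ hx)

/-- The straightening step: a column increasing tableau that is not row increasing has a set of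
letters which supports a Garnir relation, all of whose terms outside the column class of the
tableau have a larger column weight. -/
theorem exists_garnir_set {a : Tableau n μ} (ha : a.ColIncreasing) (hr : ¬ a.RowIncreasing) :
    ∃ Z : Finset (Fin n),
      (∀ b : Tableau n μ, b.col = a.col → ∃ k ∈ Z, ∃ l ∈ Z, k ≠ l ∧ b.row k = b.row l) ∧
      ∀ π : Equiv.Perm (Fin n), (∀ k, k ∉ Z → π k = k) → (a.permute π).col ≠ a.col →
        a.colWeight < (a.permute π).colWeight := by
  simp only [Tableau.RowIncreasing, not_forall] at hr
  obtain ⟨k, l, hkl, hc, hlt⟩ := hr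
  have hlk : l < k := lt_of_le_of_ne (not_lt.1 hlt) fun e => by simp [e] at hc
  -- At a row descent `l < k`, with `k` left of `l`: `X` is the column of `k` from `k` downwards,
  -- `Y` the column of `l` down to `l`. Column increase puts every letter of `Y` below every letter
  -- of `X` in size.
  let X := Finset.univ.filter fun m => a.col m = a.col k ∧ ¬ a.row m < a.row k
  let Y := Finset.univ.filter fun m => a.col m = a.col l ∧ a.row m < a.row k + 1
  have memX : ∀ m, m ∈ X ↔ a.col m = a.col k ∧ ¬ a.row m < a.row k := fun m => by simp [X]
  have memY : ∀ m, m ∈ Y ↔ a.col m = a.col l ∧ a.row m < a.row k + 1 := fun m => by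
    simp only [Y, Finset.mem_filter, Finset.mem_univ, true_and]
  have hX : ∀ x ∈ X, k ≤ x := fun x hx => by
    rw [memX] at hx
    rcases (not_lt.1 hx.2).lt_or_eq with h | h
    · exact (ha k x hx.1.symm h).le
    · exact (a.eq_of_row_col h hx.1.symm).le
  have hY : ∀ y ∈ Y, y ≤ l := fun y hy => by
    rw [memY, hkl, Nat.lt_succ_iff] at hy
    rcases hy.2.lt_or_eq with h | h
    · exact (ha y l hy.1 h).le
    · exact (a.eq_of_row_col h hy.1).le
  have hdisj : Disjoint X Y := Finset.disjoint_left.2 fun m h1 h2 =>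
    hc.ne (((memX m).1 h1).1.symm.trans ((memY m).1 h2).1)
  have hcard : (X ∪ Y).card = μ.colLen (a.col k) + 1 := by
    rw [Finset.card_union_of_disjoint hdisj]
    have h1 : Y.card = a.row k + 1 := by
      rw [a.card_col_eq_row_lt, min_eq_right]
      rw [hkl]; exact a.row_lt l
    have h2 : X.card + a.row k = μ.colLen (a.col k) := by
      rw [← (a.card_col_eq_row_lt (a.row k) (a.col k)).trans (min_eq_right (a.row_lt k).le),
        ← (a.card_col_eq_row_lt (μ.colLen (a.col k)) (a.col k)).trans (min_self _),
        add_comm, ← Finset.card_union_of_disjoint]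
      · congr 1
        ext m
        simp only [X, Finset.mem_union, Finset.mem_filter, Finset.mem_univ, true_and]
        constructor
        · rintro (h | h) <;> exact ⟨h.1, h.1 ▸ a.row_lt m⟩
        · rintro ⟨h, -⟩
          by_cases h' : a.row m < a.row k
          · exact Or.inl ⟨h, h'⟩
          · exact Or.inr ⟨h, h'⟩
      · rw [Finset.disjoint_left]
        intro m h1 h2
        simp only [Finset.mem_filter, Finset.mem_univ, true_and] at h1
        exact ((memX m).1 h2).2 h1.2
    omega
  refine ⟨X ∪ Y, fun b hb => ?_, fun π hπ hne => ?_⟩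
  -- Pigeonhole: both columns have length at most `μ.colLen (a.col k)`, one less than the number of
  -- letters.
  · obtain ⟨x, hx, y, hy, hxy, h⟩ := Finset.exists_ne_map_eq_of_card_lt_of_maps_to
      (s := X ∪ Y) (t := Finset.range (μ.colLen (a.col k))) (f := b.row)
      (by rw [hcard, Finset.card_range]; exact Nat.lt_succ_self _) (fun m hm => by
        have h1 := b.row_lt m
        rw [hb] at h1
        simp only [Finset.coe_range, Set.mem_Iio]
        rcases Finset.mem_union.1 hm with hm | hm
        · rwa [((memX m).1 hm).1] at h1
        · rw [((memY m).1 hm).1] at h1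
          exact h1.trans_le (μ.colLen_anti _ _ hc.le))
    exact ⟨x, hx, y, hy, hxy, h⟩
  · have hZ : ∀ m ∈ X ∪ Y, π m ∈ X ∪ Y := fun m hm => by
      by_contra h
      exact h (by rwa [π.injective (hπ _ h)])
    have hXY : ∀ m ∈ X, m ∉ Y := fun m h1 h2 => Finset.disjoint_left.1 hdisj h1 h2
    obtain ⟨m, hm⟩ : ∃ m, a.col (π m) ≠ a.col m := by
      by_contra! h
      exact hne (funext fun m => by rw [Tableau.col_permute, ← h, Equiv.apply_symm_apply])
    have hmZ : m ∈ X ∪ Y := by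
      by_contra h
      exact hm (by rw [hπ m h])
    -- A letter crossing between `X` and `Y` forces another to cross back, by counting; this pair
    -- makes the rearrangement inequality strict.
    obtain ⟨x, y, hx, hy, hπx, hπy⟩ : ∃ x y, x ∈ X ∧ y ∈ Y ∧ π x ∈ Y ∧ π y ∈ X := by
      rcases Finset.mem_union.1 hmZ with h | h
      · have hmY : π m ∈ Y := (Finset.mem_union.1 (hZ m hmZ)).resolve_left fun h' =>
          hm (((memX _).1 h').1.trans ((memX _).1 h).1.symm)
        obtain ⟨y, hy, hy'⟩ := exists_mem_apply_notMem π (hXY m h) hmY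
        exact ⟨m, y, h, hy, hmY,
          (Finset.mem_union.1 (hZ y (Finset.mem_union_right _ hy))).resolve_right hy'⟩
      · have hmX : π m ∈ X := (Finset.mem_union.1 (hZ m hmZ)).resolve_right fun h' =>
          hm (((memY _).1 h').1.trans ((memY _).1 h).1.symm)
        obtain ⟨x, hx, hx'⟩ := exists_mem_apply_notMem π (fun h' => hXY m h' h) hmX
        exact ⟨x, m, hx, h,
          (Finset.mem_union.1 (hZ x (Finset.mem_union_left _ hx))).resolve_left hx', hmX⟩
    have hlt : ∀ x ∈ X, ∀ y ∈ Y, y < x := fun x hx y hy =>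
      (hY y hy).trans_lt (hlk.trans_le (hX x hx))
    rw [Tableau.colWeight_permute]
    refine Tableau.sum_mul_lt_of_antivary hπ (fun p hp q hq hpq => ?_)
      (Finset.mem_union_left _ hx) (Finset.mem_union_right _ hy) ?_ (hlt _ hπy _ hπx)
    · rcases Finset.mem_union.1 hp with h1 | h1 <;> rcases Finset.mem_union.1 hq with h2 | h2
      · rw [((memX _).1 h1).1, ((memX _).1 h2).1] at hpq
        exact absurd hpq (lt_irrefl _)
      · exact hlt _ h1 _ h2
      · rw [((memY _).1 h1).1, ((memX _).1 h2).1] at hpq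
        exact absurd hpq hc.not_gt
      · rw [((memY _).1 h1).1, ((memY _).1 h2).1] at hpq
        exact absurd hpq (lt_irrefl _)
    · rw [((memX _).1 hx).1, ((memY _).1 hy).1]
      exact hc

/-- A linear form that vanishes on the standard polytabloids vanishes on all polytabloids. -/
theorem eq_zero_of_standard (f : PermModule n μ →ₗ[ℤ] ℤ)
    (hf : ∀ a : Tableau n μ, a.ColIncreasing → a.RowIncreasing → f (polytabloid a) = 0)
    (a : Tableau n μ) : f (polytabloid a) = 0 := by
  by_contra hbad
  -- In a counterexample of maximal column weight, the Garnir terms outside the column class vanish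
  -- under `f` and those inside all equal `f (polytabloid c)`. So a positive multiple of that value
  -- is zero; no division is needed because `f` takes values in ℤ.
  obtain ⟨b, hb, hmax⟩ := Finset.exists_max_image
    (Finset.univ.filter fun b : Tableau n μ => f (polytabloid b) ≠ 0) Tableau.colWeight
      ⟨a, by simpa using hbad⟩
  simp only [Finset.mem_filter, Finset.mem_univ, true_and] at hb hmax
  obtain ⟨c, hcol, hc, -⟩ := b.exists_colIncreasing_max
  have hfc : f (polytabloid c) ≠ 0 := by
    rw [polytabloid_of_col_eq hcol, map_smul]
    exact smul_ne_zero (Units.ne_zero _) hb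
  have hw : c.colWeight = b.colWeight := by rw [Tableau.colWeight, hcol, Tableau.colWeight]
  obtain ⟨Z, hZ, hZw⟩ := exists_garnir_set hc fun hr => hfc (hf c hc hr)
  have hsum := congrArg f (sum_sign_smul_polytabloid c Z hZ)
  rw [map_sum, map_zero] at hsum
  have hterm : ∀ π ∈ Finset.univ.filter fun π : Equiv.Perm (Fin n) => ∀ k, k ∉ Z → π k = k,
      f ((sign π : ℤ) • polytabloid (c.permute π)) =
        if (c.permute π).col = c.col then f (polytabloid c) else 0 := fun π hπ => by
    simp only [Finset.mem_filter, Finset.mem_univ, true_and] at hπ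
    split_ifs with h
    · rw [polytabloid_of_col_eq h, c.symm_trans_permute, smul_smul, ← Units.val_mul,
        Int.units_mul_self, Units.val_one, one_smul]
    · have h0 : f (polytabloid (c.permute π)) = 0 := by
        by_contra hne
        exact absurd (hmax _ hne) (not_le.2 (hw ▸ hZw π hπ h))
      rw [map_smul, h0, smul_zero]
  rw [Finset.sum_congr rfl hterm, ← Finset.sum_filter, Finset.sum_const, smul_eq_zero] at hsum
  refine hsum.elim (fun h => ?_) hfc
  rw [Finset.card_eq_zero] at h
  have : (1 : Equiv.Perm (Fin n)) ∈ (∅ : Finset (Equiv.Perm (Fin n))) := by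
    rw [← h]
    simp only [Finset.mem_filter, Finset.mem_univ, true_and]
    exact ⟨fun _ _ => rfl, rfl⟩
  simp at this

end Specht

namespace Specht

open Matrix
open Equiv.Perm (sign)

/-! ### The signed incidence matrix and its equivariance. -/

variable {n : ℕ} {μ : YoungDiagram}

/-- Transposition of tableaux. -/
def Tableau.transposeEquiv (n : ℕ) (μ : YoungDiagram) : Tableau n μ ≃ Tableau n μ.transpose :=
  Equiv.equivCongr ((Equiv.prodComm ℕ ℕ).subtypeEquiv fun c => by
    rw [YoungDiagram.mem_cells, YoungDiagram.mem_cells, YoungDiagram.mem_transpose]; rfl)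
    (Equiv.refl _)

/-- The transposed tableau. -/
def Tableau.transpose (a : Tableau n μ) : Tableau n μ.transpose := Tableau.transposeEquiv n μ a

theorem Tableau.row_transpose (a : Tableau n μ) : a.transpose.row = a.col := rfl

theorem Tableau.col_transpose (a : Tableau n μ) : a.transpose.col = a.row := rfl

theorem Tableau.symm_trans_transpose (a b : Tableau n μ) :
    a.transpose.symm.trans b.transpose = a.symm.trans b := rfl

theorem exists_tabloid_eq (s : Tabloid n μ) : ∃ a, tabloid a = s := Quotient.exists_rep s

theorem exists_tabloid_transpose_eq (t : Tabloid n μ.transpose) :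
    ∃ a : Tableau n μ, tabloid a.transpose = t := by
  obtain ⟨a, ha⟩ := exists_tabloid_eq t
  exact ⟨(Tableau.transposeEquiv n μ).symm a, by
    rw [Tableau.transpose, Equiv.apply_symm_apply, ha]⟩

/-- The operation of a permutation on the tableaux. -/
def Tableau.permuteEquiv (n : ℕ) (μ : YoungDiagram) (π : Equiv.Perm (Fin n)) :
    Tableau n μ ≃ Tableau n μ := Equiv.equivCongr (Equiv.refl _) π

theorem Tableau.permuteEquiv_apply (π : Equiv.Perm (Fin n)) (a : Tableau n μ) :
    Tableau.permuteEquiv n μ π a = a.permute π := rfl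

/-- The operation of a permutation on the tabloids. -/
def tabloidPerm (n : ℕ) (μ : YoungDiagram) (π : Equiv.Perm (Fin n)) :
    Tabloid n μ ≃ Tabloid n μ :=
  Quotient.congr (Tableau.permuteEquiv n μ π) fun a b => by
    change (∀ k, a.row k = b.row k) ↔ ∀ k, a.row (π.symm k) = b.row (π.symm k)
    exact ⟨fun h k => h _, fun h k => by simpa using h (π k)⟩

theorem tabloidPerm_tabloid (π : Equiv.Perm (Fin n)) (a : Tableau n μ) :
    tabloidPerm n μ π (tabloid a) = tabloid (a.permute π) := rfl

theorem tabloidPerm_tabloid_transpose (π : Equiv.Perm (Fin n)) (a : Tableau n μ) :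
    tabloidPerm n μ.transpose π (tabloid a.transpose) = tabloid (a.permute π).transpose := rfl

/-- The signed incidence matrix between the tabloids and the transposed tabloids: a tableau `b`
contributes its sign, relative to the tableau `a₀`, to the position given by its rows and its
columns. -/
noncomputable def incidence (a₀ : Tableau n μ) :
    Matrix (Tabloid n μ) (Tabloid n μ.transpose) ℤ :=
  of fun s t => ∑ b : Tableau n μ, if tabloid b = s ∧ tabloid b.transpose = t then
    (sign (a₀.symm.trans b) : ℤ) else 0

theorem polytabloid_apply (a : Tableau n μ) (s : Tabloid n μ) :
    polytabloid a s = ∑ b : Tableau n μ, if tabloid b = s ∧ b.col = a.col then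
      (sign (a.symm.trans b) : ℤ) else 0 := by
  rw [polytabloid_eq_sum, Finsupp.finsetSum_apply, Finset.sum_filter]
  refine Finset.sum_congr rfl fun b _ => ?_
  by_cases h1 : b.col = a.col <;> by_cases h2 : tabloid b = s <;> simp [h1, h2]

/-- Fixing the columns selects the column class of `a`; the sign of `a` relative to `a₀` turns the
signs relative to `a₀` into signs relative to `a`. -/
theorem polytabloid_apply_eq (a₀ a : Tableau n μ) (s : Tabloid n μ) :
    polytabloid a s = sign (a₀.symm.trans a) * incidence a₀ s (tabloid a.transpose) := by
  rw [polytabloid_apply, incidence, of_apply, Finset.mul_sum]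
  refine Finset.sum_congr rfl fun b _ => ?_
  simp only [tabloid_eq_iff (a := b.transpose), Tableau.row_transpose]
  rw [mul_ite, mul_zero, ← Units.val_mul, sign_symm_trans_comm a₀ a, sign_symm_trans_mul]

theorem polytabloid_transpose_apply_eq (a₀ a : Tableau n μ) (t : Tabloid n μ.transpose) :
    polytabloid a.transpose t = sign (a₀.symm.trans a) * incidence a₀ (tabloid a) t := by
  rw [polytabloid_apply, incidence, of_apply, Finset.mul_sum,
    ← Equiv.sum_comp (Tableau.transposeEquiv n μ)]
  refine Finset.sum_congr rfl fun b _ => ?_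
  change (if tabloid b.transpose = t ∧ b.transpose.col = a.transpose.col then
    (sign (a.transpose.symm.trans b.transpose) : ℤ) else 0) = _
  simp only [tabloid_eq_iff (a := b), Tableau.col_transpose, Tableau.symm_trans_transpose]
  rw [mul_ite, mul_zero, ← Units.val_mul, sign_symm_trans_comm a₀ a, sign_symm_trans_mul]
  exact if_congr and_comm rfl rfl

theorem incidence_apply_eq (a₀ a : Tableau n μ) (s : Tabloid n μ) :
    incidence a₀ s (tabloid a.transpose) = sign (a₀.symm.trans a) * polytabloid a s := by
  rw [polytabloid_apply_eq a₀, ← mul_assoc, ← Units.val_mul, Int.units_mul_self, Units.val_one,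
    one_mul]

theorem incidence_apply_eq_transpose (a₀ a : Tableau n μ) (t : Tabloid n μ.transpose) :
    incidence a₀ (tabloid a) t = sign (a₀.symm.trans a) * polytabloid a.transpose t := by
  rw [polytabloid_transpose_apply_eq a₀, ← mul_assoc, ← Units.val_mul, Int.units_mul_self,
    Units.val_one, one_mul]

theorem eq_of_tabloid_eq {a b : Tableau n μ} (h : tabloid a = tabloid b)
    (h' : tabloid a.transpose = tabloid b.transpose) : a = b :=
  Tableau.ext_row_col (tabloid_eq_iff.1 h) (tabloid_eq_iff.1 h')

theorem incidence_self (a₀ a : Tableau n μ) :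
    incidence a₀ (tabloid a) (tabloid a.transpose) = sign (a₀.symm.trans a) := by
  rw [incidence, of_apply, Finset.sum_eq_single a]
  · simp
  · exact fun b _ hb => if_neg fun h => hb (eq_of_tabloid_eq h.1 h.2)
  · simp

theorem polytabloid_apply_self (a : Tableau n μ) : polytabloid a (tabloid a) = 1 := by
  rw [polytabloid_apply_eq a, incidence_self, ← Units.val_mul, Int.units_mul_self, Units.val_one]

/-- Equivariance, up to sign, of a matrix under the symmetric group. -/
def SignEquivariant (Y : Matrix (Tabloid n μ) (Tabloid n μ.transpose) ℤ) : Prop :=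
  ∀ π : Equiv.Perm (Fin n), Y.submatrix (tabloidPerm n μ π) (tabloidPerm n μ.transpose π) =
    (sign π : ℤ) • Y

theorem signEquivariant_incidence (a₀ : Tableau n μ) : SignEquivariant (incidence a₀) := by
  intro π
  ext s t
  rw [submatrix_apply, Matrix.smul_apply, incidence, of_apply, of_apply, smul_eq_mul, Finset.mul_sum,
    ← Equiv.sum_comp (Tableau.permuteEquiv n μ π)]
  refine Finset.sum_congr rfl fun b _ => ?_
  simp only [Tableau.permuteEquiv_apply, ← tabloidPerm_tabloid, ← tabloidPerm_tabloid_transpose,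
    (tabloidPerm n μ π).apply_eq_iff_eq, (tabloidPerm n μ.transpose π).apply_eq_iff_eq]
  rw [mul_ite, mul_zero, ← sign_symm_trans_mul a₀ b, b.symm_trans_permute, Units.val_mul, mul_comm]

theorem SignEquivariant.apply {Y : Matrix (Tabloid n μ) (Tabloid n μ.transpose) ℤ}
    (hY : SignEquivariant Y) (π : Equiv.Perm (Fin n)) (a b : Tableau n μ) :
    Y (tabloid (a.permute π)) (tabloid (b.permute π).transpose) =
      sign π * Y (tabloid a) (tabloid b.transpose) :=
  congrFun (congrFun (hY π) (tabloid a)) (tabloid b.transpose)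

/-- The swap of `k` and `l` fixes both tabloids, so the entry equals its negative. -/
theorem SignEquivariant.eq_zero {Y : Matrix (Tabloid n μ) (Tabloid n μ.transpose) ℤ}
    (hY : SignEquivariant Y) {a b : Tableau n μ} {k l : Fin n} (hkl : k ≠ l)
    (hr : a.row k = a.row l) (hc : b.col k = b.col l) :
    Y (tabloid a) (tabloid b.transpose) = 0 := by
  have h := hY.apply (Equiv.swap k l) a b
  have ha : tabloid (a.permute (Equiv.swap k l)) = tabloid a := by
    rw [tabloid_eq_iff]
    funext m
    rw [Tableau.row_permute, Equiv.symm_swap, Equiv.swap_apply_def]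
    split_ifs with h1 h2
    · rw [h1, hr]
    · rw [h2, hr]
    · rfl
  have hb : tabloid (b.permute (Equiv.swap k l)).transpose = tabloid b.transpose := by
    rw [tabloid_eq_iff, Tableau.row_transpose, Tableau.row_transpose]
    funext m
    rw [Tableau.col_permute, Equiv.symm_swap, Equiv.swap_apply_def]
    split_ifs with h1 h2
    · rw [h1, hc]
    · rw [h2, hc]
    · rfl
  rw [ha, hb, Equiv.Perm.sign_swap hkl] at h
  simp only [Units.val_neg, Units.val_one] at h
  omega

/-- Every equivariant matrix is a multiple of the incidence matrix. -/
theorem SignEquivariant.eq_smul {Y : Matrix (Tabloid n μ) (Tabloid n μ.transpose) ℤ}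
    (hY : SignEquivariant Y) (a₀ : Tableau n μ) :
    Y = Y (tabloid a₀) (tabloid a₀.transpose) • incidence a₀ := by
  ext s t
  obtain ⟨a, rfl⟩ := exists_tabloid_eq s
  obtain ⟨b, rfl⟩ := exists_tabloid_transpose_eq t
  rw [Matrix.smul_apply, smul_eq_mul]
  by_cases h : ∀ k l, a.row k = a.row l → b.col k = b.col l → k = l
  · obtain ⟨c, hr, hc⟩ := a.exists_row_eq_col_eq b h
    rw [← tabloid_eq_iff] at hr
    have hc' : tabloid c.transpose = tabloid b.transpose := tabloid_eq_iff.2 hc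
    rw [← hr, ← hc', incidence_self, mul_comm, ← hY.apply, Tableau.permute_symm_trans]
  · push Not at h
    obtain ⟨k, l, hr, hc, hkl⟩ := h
    rw [hY.eq_zero hkl hr hc, (signEquivariant_incidence a₀).eq_zero hkl hr hc, mul_zero]

/-- Each of the three factors contributes one sign, and the cube of a sign is that sign. -/
theorem exists_incidence_mul_eq (a₀ : Tableau n μ) :
    ∃ c : ℤ, incidence a₀ * (incidence a₀)ᵀ * incidence a₀ = c • incidence a₀ := by
  refine ⟨_, SignEquivariant.eq_smul (fun π => ?_) a₀⟩
  have h := signEquivariant_incidence a₀ π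
  rw [← submatrix_mul_equiv _ _ _ (tabloidPerm n μ π), ← submatrix_mul_equiv _ _ _
    (tabloidPerm n μ.transpose π), ← transpose_submatrix, h, transpose_smul, Matrix.smul_mul,
    Matrix.smul_mul, Matrix.mul_smul, Matrix.mul_smul, smul_smul ((sign π : ℤ)) (sign π : ℤ),
    ← Units.val_mul, Int.units_mul_self, Units.val_one, one_smul, Matrix.smul_mul]

theorem card_tableau (a₀ : Tableau n μ) : Fintype.card (Tableau n μ) = n.factorial := by
  rw [Fintype.card_equiv a₀, Fintype.card_congr a₀, Fintype.card_fin]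

/-- The trace is the sum of squared entries, and each tableau contributes 1 at a position of its
own. -/
theorem trace_incidence_mul (a₀ : Tableau n μ) :
    (incidence a₀ * (incidence a₀)ᵀ).trace = n.factorial := by
  have hsq : ∀ s t, incidence a₀ s t * incidence a₀ s t =
      ∑ b : Tableau n μ, if tabloid b = s ∧ tabloid b.transpose = t then 1 else 0 := fun s t => by
    by_cases h : ∃ b : Tableau n μ, tabloid b = s ∧ tabloid b.transpose = t
    · obtain ⟨a, rfl, rfl⟩ := h
      rw [incidence_self, ← Units.val_mul, Int.units_mul_self, Finset.sum_eq_single a]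
      · simp
      · exact fun b _ hb => if_neg fun h => hb (eq_of_tabloid_eq h.1 h.2)
      · simp
    · push Not at h
      have h' : ∀ b : Tableau n μ, ¬ (tabloid b = s ∧ tabloid b.transpose = t) :=
        fun b hb => h b hb.1 hb.2
      simp only [incidence, of_apply, if_neg (h' _), Finset.sum_const_zero, mul_zero]
  simp only [trace, diag_apply, mul_apply, transpose_apply, hsq]
  rw [Finset.sum_congr rfl fun s _ => Finset.sum_comm, Finset.sum_comm, ← card_tableau a₀]
  simp [ite_and]

/-! ### Standard polytabloids and the integral factorization of the incidence matrix. -/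

/-- The standard tableaux. -/
abbrev StandardTableau (n : ℕ) (μ : YoungDiagram) : Type :=
  {a : Tableau n μ // a.ColIncreasing ∧ a.RowIncreasing}

noncomputable instance (n : ℕ) (μ : YoungDiagram) : Fintype (StandardTableau n μ) :=
  Fintype.ofFinite _

/-- The coefficients of the standard polytabloids. -/
noncomputable def standardMatrix (n : ℕ) (μ : YoungDiagram) :
    Matrix (Tabloid n μ) (StandardTableau n μ) ℤ :=
  of fun s t => polytabloid t.1 s

/-- The coefficients of the standard polytabloids at the standard tabloids. -/
noncomputable def standardMinor (n : ℕ) (μ : YoungDiagram) :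
    Matrix (StandardTableau n μ) (StandardTableau n μ) ℤ :=
  (standardMatrix n μ).submatrix (fun s => tabloid s.1) id

theorem eq_or_rowWeight_lt_of_standardMinor_ne_zero {s t : StandardTableau n μ}
    (h : standardMinor n μ s t ≠ 0) : s = t ∨ s.1.rowWeight < t.1.rowWeight := by
  simp only [standardMinor, standardMatrix, submatrix_apply, of_apply, id, polytabloid_apply] at h
  obtain ⟨b, -, hb⟩ := Finset.exists_ne_zero_of_sum_ne_zero h
  obtain ⟨hr, hc⟩ : tabloid b = tabloid s.1 ∧ b.col = t.1.col := by
    by_contra hn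
    exact hb (if_neg hn)
  rw [tabloid_eq_iff] at hr
  rcases t.2.1.eq_or_rowWeight_lt hc with rfl | hlt
  · exact Or.inl (Subtype.ext (s.2.2.eq t.2.2 hr.symm))
  · right
    rwa [Tableau.rowWeight, ← hr]

/-- Unitriangular for the row weight. Distinct standard tableaux may have equal weight, hence
blocks, which are identity matrices. -/
theorem det_standardMinor (n : ℕ) (μ : YoungDiagram) : (standardMinor n μ).det = 1 := by
  have hbt : (standardMinor n μ).BlockTriangular fun s => s.1.rowWeight := fun s t hst => by
    by_contra h
    rcases eq_or_rowWeight_lt_of_standardMinor_ne_zero h with rfl | h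
    · exact lt_irrefl _ hst
    · exact hst.not_gt h
  rw [hbt.det]
  refine Finset.prod_eq_one fun w _ => ?_
  have : (standardMinor n μ).toSquareBlock (fun s => s.1.rowWeight) w = 1 := by
    ext s t
    rw [toSquareBlock_def, of_apply, one_apply]
    split_ifs with h
    · rw [h]
      exact polytabloid_apply_self _
    · by_contra hne
      rcases eq_or_rowWeight_lt_of_standardMinor_ne_zero hne with h' | h'
      · exact h (Subtype.ext h')
      · exact h'.ne (s.2.trans t.2.symm)
  rw [this, det_one]

theorem inv_mul_standardMinor (n : ℕ) (μ : YoungDiagram) :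
    (standardMinor n μ)⁻¹ * standardMinor n μ = 1 :=
  nonsing_inv_mul _ (by rw [det_standardMinor]; exact isUnit_one)

/-- The coefficients that express the columns of the incidence matrix by the standard
polytabloids. -/
noncomputable def straightening (a₀ : Tableau n μ) :
    Matrix (StandardTableau n μ) (Tabloid n μ.transpose) ℤ :=
  (standardMinor n μ)⁻¹ * ((incidence a₀).submatrix (fun s => tabloid s.1) id :
    Matrix (StandardTableau n μ) (Tabloid n μ.transpose) ℤ)

theorem incidence_eq_mul (a₀ : Tableau n μ) :
    incidence a₀ = standardMatrix n μ * straightening a₀ := by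
  ext s t
  obtain ⟨a, rfl⟩ := exists_tabloid_transpose_eq t
  -- The error in recovering the coordinate at `s` from those at standard tabloids. It vanishes on
  -- standard polytabloids, hence on all; the unimodular minor keeps the recovery integral.
  let f : PermModule n μ →ₗ[ℤ] ℤ := Finsupp.lapply s - ∑ r : StandardTableau n μ,
    (standardMatrix n μ * (standardMinor n μ)⁻¹) s r • Finsupp.lapply (tabloid r.1)
  have hf : ∀ x, f x = x s - ∑ r : StandardTableau n μ,
      (standardMatrix n μ * (standardMinor n μ)⁻¹) s r * x (tabloid r.1) := fun x => by
    simp [f, LinearMap.sum_apply]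
  have h0 := eq_zero_of_standard f (fun b hc hr => by
    have e : (standardMatrix n μ * (standardMinor n μ)⁻¹ * standardMinor n μ) s ⟨b, hc, hr⟩ =
        standardMatrix n μ s ⟨b, hc, hr⟩ := by
      rw [Matrix.mul_assoc, inv_mul_standardMinor, Matrix.mul_one]
    rw [hf, sub_eq_zero]
    rw [mul_apply] at e
    exact e.symm) a
  rw [hf, sub_eq_zero] at h0
  rw [straightening, ← Matrix.mul_assoc, mul_apply, incidence_apply_eq, h0, Finset.mul_sum]
  refine Finset.sum_congr rfl fun r _ => ?_
  rw [submatrix_apply, id, incidence_apply_eq, mul_left_comm]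

theorem exists_mul_standardMatrix (n : ℕ) (μ : YoungDiagram) :
    ∃ L : Matrix (StandardTableau n μ) (Tabloid n μ) ℤ, L * standardMatrix n μ = 1 := by
  refine ⟨(standardMinor n μ)⁻¹ * ((1 : Matrix _ _ ℤ).submatrix (fun s => tabloid s.1) id :
    Matrix (StandardTableau n μ) (Tabloid n μ) ℤ), ?_⟩
  rw [Matrix.mul_assoc]
  convert inv_mul_standardMinor n μ using 2
  ext s t
  simp [standardMinor, mul_apply, one_apply]

theorem exists_straightening_mul (a₀ : Tableau n μ) :
    ∃ R : Matrix (Tabloid n μ.transpose) (StandardTableau n μ) ℤ, straightening a₀ * R = 1 := by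
  -- Selects the columns at the transposed standard tabloids, with the signs that turn them into
  -- standard polytabloids.
  refine ⟨of fun t r => if t = tabloid r.1.transpose then (sign (a₀.symm.trans r.1) : ℤ) else 0, ?_⟩
  rw [straightening, Matrix.mul_assoc]
  convert inv_mul_standardMinor n μ using 2
  ext s t
  simp only [mul_apply, submatrix_apply, of_apply, id, mul_ite, mul_zero, Finset.sum_ite_eq',
    Finset.mem_univ, if_true]
  rw [standardMinor, standardMatrix, submatrix_apply, of_apply, id, polytabloid_apply_eq a₀,
    mul_comm]

theorem exists_spechtModule_equiv (a₀ : Tableau n μ) :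
    ∃ E : spechtModule n μ ≃ₗ[ℤ] (StandardTableau n μ → ℤ),
      ∀ x : spechtModule n μ, ⇑(x : PermModule n μ) = standardMatrix n μ *ᵥ E x := by
  classical
  obtain ⟨L, hL⟩ := exists_mul_standardMatrix n μ
  refine exists_equiv_of_span hL (fun a => ?_) fun r =>
    ⟨polytabloid r.1, Submodule.subset_span ⟨r.1, rfl⟩, rfl⟩
  refine ⟨(sign (a₀.symm.trans a) : ℤ) • (straightening a₀).col (tabloid a.transpose), ?_⟩
  ext s
  rw [polytabloid_apply_eq a₀, incidence_eq_mul, mulVec_smul]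
  rfl

theorem exists_spechtModule_transpose_equiv (a₀ : Tableau n μ) :
    ∃ E : spechtModule n μ.transpose ≃ₗ[ℤ] (StandardTableau n μ → ℤ),
      ∀ x : spechtModule n μ.transpose,
        ⇑(x : PermModule n μ.transpose) = (straightening a₀)ᵀ *ᵥ E x := by
  classical
  obtain ⟨R, hR⟩ := exists_straightening_mul a₀
  refine exists_equiv_of_span (L := Rᵀ) (by rw [← transpose_mul, hR, transpose_one])
    (fun a => ?_) fun r => ?_
  · obtain ⟨a, rfl⟩ := (Tableau.transposeEquiv n μ).surjective a
    refine ⟨(sign (a₀.symm.trans a) : ℤ) • (standardMatrix n μ).row (tabloid a), ?_⟩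
    ext t
    change polytabloid a.transpose t = _
    rw [polytabloid_transpose_apply_eq a₀, incidence_eq_mul, mulVec_smul, mulVec_transpose]
    rfl
  -- By definition the rows of `straightening a₀` are integral combinations of the rows of the
  -- incidence matrix at standard tabloids, which are signed polytabloids of `μ.transpose`.
  · refine ⟨∑ q : StandardTableau n μ, (standardMinor n μ)⁻¹ r q •
      ((sign (a₀.symm.trans q.1) : ℤ) • polytabloid q.1.transpose),
      Submodule.sum_mem _ fun q _ => Submodule.smul_mem _ _ (Submodule.smul_mem _ _
        (Submodule.subset_span ⟨_, rfl⟩)), ?_⟩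
    ext t
    rw [Finsupp.finsetSum_apply, col_apply, transpose_apply, straightening, mul_apply]
    refine Finset.sum_congr rfl fun q _ => ?_
    rw [Finsupp.smul_apply, Finsupp.smul_apply, submatrix_apply, id, incidence_apply_eq_transpose]
    rfl

theorem exists_gram_mul_eq (a₀ : Tableau n μ) :
    ∃ c : ℕ, (standardMatrix n μ)ᵀ * standardMatrix n μ *
        (straightening a₀ * (straightening a₀)ᵀ) = (c : ℤ) • 1 ∧
      c * Fintype.card (StandardTableau n μ) = n.factorial := by
  classical
  obtain ⟨L, hL⟩ := exists_mul_standardMatrix n μ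
  obtain ⟨R, hR⟩ := exists_straightening_mul a₀
  obtain ⟨c, hc⟩ := exists_incidence_mul_eq a₀
  have htr := trace_incidence_mul a₀
  set P := standardMatrix n μ
  set Q := straightening a₀
  rw [show incidence a₀ = P * Q from incidence_eq_mul a₀, transpose_mul] at hc htr
  -- Cancel the outer `P` on the left and the outer `Q` on the right of the cubic relation.
  have hYX : Q * Qᵀ * (Pᵀ * P) = c • 1 := by
    have h1 : L * (P * Q * (Qᵀ * Pᵀ) * (P * Q)) * R =
        (L * P) * (Q * Qᵀ * (Pᵀ * P)) * (Q * R) := by simp only [Matrix.mul_assoc]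
    have h2 : L * (P * Q * (Qᵀ * Pᵀ) * (P * Q)) * R = c • ((L * P) * (Q * R)) := by
      rw [hc, Matrix.mul_smul, Matrix.smul_mul]
      simp only [Matrix.mul_assoc]
    rw [h1, hL, hR, Matrix.one_mul, Matrix.mul_one, Matrix.mul_one] at h2
    exact h2
  have hcard : c * Fintype.card (StandardTableau n μ) = n.factorial := by
    have h1 : P * Q * (Qᵀ * Pᵀ) = P * (Q * Qᵀ * Pᵀ) := by simp only [Matrix.mul_assoc]
    rw [h1, trace_mul_comm, Matrix.mul_assoc, hYX, trace_smul, trace_one, smul_eq_mul] at htr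
    exact htr
  have hpos : 0 < c := by
    have : (0 : ℤ) < c * Fintype.card (StandardTableau n μ) := by
      rw [hcard]; exact_mod_cast n.factorial_pos
    exact pos_of_mul_pos_left this (by positivity)
  lift c to ℕ using hpos.le
  refine ⟨c, ?_, by exact_mod_cast hcard⟩
  have := congrArg Matrix.transpose hYX
  simpa only [transpose_mul, transpose_transpose, transpose_smul, transpose_one] using this

end Specht

/-! ### The main theorem. -/

theorem mainTheorem6 (n : ℕ) (hn : 1 ≤ n) (μ : YoungDiagram) (hμ : μ.card = n) :
    0 < Specht.spechtRank n μ ∧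
    Specht.spechtRank n μ.transpose = Specht.spechtRank n μ ∧
    Specht.spechtRank n μ ∣ n.factorial ∧
    ∀ (b : Module.Basis (Fin (Specht.spechtRank n μ)) ℤ (Specht.spechtModule n μ))
      (b' : Module.Basis (Fin (Specht.spechtRank n μ.transpose)) ℤ
        (Specht.spechtModule n μ.transpose)),
      (∃ d, Specht.IsElementaryDivisors (Specht.gramMatrix b) d) ∧
      (∃ d', Specht.IsElementaryDivisors (Specht.gramMatrix b') d') ∧
      ∀ d d', Specht.IsElementaryDivisors (Specht.gramMatrix b) d →
        Specht.IsElementaryDivisors (Specht.gramMatrix b') d' →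
        -- with positions counted from 1, the positions below add up to the rank plus 1
        (∀ (i : Fin (Specht.spechtRank n μ)) (j : Fin (Specht.spechtRank n μ.transpose)),
          ((i : ℕ) + 1) + ((j : ℕ) + 1) = Specht.spechtRank n μ + 1 →
          d i * d' j = n.factorial / Specht.spechtRank n μ) ∧
        (∀ i : Fin (Specht.spechtRank n μ), (i : ℕ) + 1 = Specht.spechtRank n μ →
          d i ∣ n.factorial / Specht.spechtRank n μ) := by
  classical
  obtain ⟨a₀⟩ : Nonempty (Specht.Tableau n μ) := by
    rw [← Fintype.card_eq, Fintype.card_fin, Fintype.card_coe]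
    exact hμ
  obtain ⟨E, hE⟩ := Specht.exists_spechtModule_equiv a₀
  obtain ⟨E', hE'⟩ := Specht.exists_spechtModule_transpose_equiv a₀
  obtain ⟨c, hXY, hc⟩ := Specht.exists_gram_mul_eq a₀
  have hr : Specht.spechtRank n μ = Fintype.card (Specht.StandardTableau n μ) := by
    rw [Specht.spechtRank, E.finrank_eq, Module.finrank_fintype_fun_eq_card]
  have hr' : Specht.spechtRank n μ.transpose = Specht.spechtRank n μ := by
    rw [hr, Specht.spechtRank, E'.finrank_eq, Module.finrank_fintype_fun_eq_card]
  rw [← hr] at hc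
  have hpos : 0 < Specht.spechtRank n μ :=
    Nat.pos_of_ne_zero fun h => n.factorial_ne_zero (by rw [← hc, h, mul_zero])
  have hdiv : n.factorial / Specht.spechtRank n μ = c := by
    rw [← hc, Nat.mul_div_cancel _ hpos]
  refine ⟨hpos, hr', Dvd.intro_left c hc, fun b b' =>
    ⟨Specht.exists_isElementaryDivisors _, Specht.exists_isElementaryDivisors _,
      fun d d' hd hd' => ?_⟩⟩
  have key : ∀ (i : Fin (Specht.spechtRank n μ)) (j : Fin (Specht.spechtRank n μ.transpose)),
      ((i : ℕ) + 1) + ((j : ℕ) + 1) = Specht.spechtRank n μ + 1 →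
      d i * d' j = n.factorial / Specht.spechtRank n μ := fun i j hij => by
    obtain ⟨g, g', hg, -, hG⟩ := Specht.gramMatrix_eq E hE b
    obtain ⟨h, h', hh, hh', hH⟩ := Specht.gramMatrix_eq E' hE' b'
    rw [hG] at hd
    rw [hH, Matrix.transpose_transpose] at hd'
    rw [hdiv]
    exact Specht.elementaryDivisors_mul_eq hXY hg hh hh' hr' hd hd' i j hij
  refine ⟨key, fun i hi => ?_⟩
  -- The last position is complementary to the first one of the transposed lattice.
  rw [← key i ⟨0, hr' ▸ hpos⟩ (by simp [hi])]
  exact Dvd.intro _ rfl
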